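/- Fix $d\in\mathbb N$. A \emph{contraction vector} is a tuple $\boldsymbol\alpha=(\alpha_1,\dots,\alpha_m)$, $m\ge 1$, with $\alpha_i\in(0,1)$ for all $i$ and $\sum_{i=1}^m\alpha_i^d<1$. Let $\mathcal D(\boldsymbol\alpha)$ be the collection of all nonempty compact sets $E\subset\mathbb R^d$ for which there are orthogonal matrices $R_i$ and vectors $b_i\in\mathbb R^d$ such that, with $f_i(x)=\alpha_iR_i(x+b_i)$, the set $E=\bigcup_{i=1}^m f_i(E)$ is the union of the pairwise disjoint sets $f_i(E)$. Two such sets $E,F$ are \emph{Lipschitz equivalent}, $E\sim F$, if there are a bijection $\phi:E\to F$ and a constant $C>0$ with $C^{-1}|x-y|\le|\phi(x)-\phi(y)|\le C|x-y|$ for all $x,y\in E$. Write $\mathcal D(\boldsymbol\alpha)\sim\mathcal D(\boldsymbol\beta)$ if $E\sim F$ for some $E\in\mathcal D(\boldsymbol\alpha)$ and $F\in\mathcal D(\boldsymbol\beta)$. For a finite word $\mathbf i=i_1\cdots i_k$ over $\{1,\dots,m\}$ put $f_{\mathbf i}=f_{i_1}\circ\cdots\circ f_{i_k}$ and $\alpha_{\mathbf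 i}=\alpha_{i_1}\cdots\alpha_{i_k}$. A set $\Lambda$ of finite words is a \emph{partition} for $E\in\mathcal D(\boldsymbol\alpha)$ (with maps $f_i$ as above) if $E=\bigcup_{\mathbf i\in\Lambda}f_{\mathbf i}(E)$ with the union disjoint. A contraction vector $\boldsymbol\alpha=(\alpha_1,\dots,\alpha_m)$ is \emph{derived} from a contraction vector $\boldsymbol\beta$ if there is a partition $\Lambda=\{\mathbf j_1,\dots,\mathbf j_m\}$ ($m$ distinct words) for some $E\in\mathcal D(\boldsymbol\beta)$ such that $\boldsymbol\alpha=(\beta_{\mathbf j_1},\dots,\beta_{\mathbf j_m})$. Write $\boldsymbol\alpha\sim\boldsymbol\beta$ if there is a finite sequence of contraction vectors $\boldsymbol\alpha=\boldsymbol\alpha_1,\dots,\boldsymbol\alpha_N=\boldsymbol\beta$ such that, for each $1\le j<N$, $\boldsymbol\alpha_{j+1}$ is derived from $\boldsymbol\alpha_j$ or $\boldsymbol\alpha_j$ is derived from $\boldsymbol\alpha_{j+1}$. \textbf{Theorem.} Let $\boldsymbol\alpha=(\alpha,\dots,\alpha)\in\mathbb R^m$ and $\boldsymbol\beta=(\beta_1,\dots,\beta_n)\in\mathbb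 R^n$ be contraction vectors with $m\ge2$ or $n\ge2$. Then $\mathcal D(\boldsymbol\alpha)\sim\mathcal D(\boldsymbol\beta)$ if and only if $\boldsymbol\alpha\sim\boldsymbol\beta$; and in that case $E\sim F$ for all $E\in\mathcal D(\boldsymbol\alpha)$ and $F\in\mathcal D(\boldsymbol\beta)$. -/

import Mathlib

/-- Lipschitz equivalence of two subsets of `ℝ^d`: there is a bi-Lipschitz bijection of `E`
onto `F`. -/
def LipEquiv {d : ℕ} (E F : Set (EuclideanSpace ℝ (Fin d))) : Prop :=
  ∃ φ : E → F, Function.Bijective φ ∧ ∃ C : ℝ, 0 < C ∧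
    ∀ x y : E, C⁻¹ * dist x y ≤ dist (φ x) (φ y) ∧ dist (φ x) (φ y) ≤ C * dist x y

/-- `α = (α_1, …, α_m)` is a contraction vector (relative to the ambient dimension `d`). -/
def IsContractionVector (d : ℕ) {m : ℕ} (α : Fin m → ℝ) : Prop :=
  (∀ i, 0 < α i ∧ α i < 1) ∧ ∑ i, α i ^ d < 1

/-- The similarities `f_i(x) = α_i R_i (x + b_i)`, with `R_i` orthogonal. -/
noncomputable def ifsMap {d m : ℕ} (α : Fin m → ℝ)
    (R : Fin m → (EuclideanSpace ℝ (Fin d) ≃ₗᵢ[ℝ] EuclideanSpace ℝ (Fin d)))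
    (b : Fin m → EuclideanSpace ℝ (Fin d)) (i : Fin m) :
    EuclideanSpace ℝ (Fin d) → EuclideanSpace ℝ (Fin d) :=
  fun x => α i • R i (x + b i)

/-- `E` is a dust-like self-similar set of the maps `f_1, …, f_m`: it is nonempty and compact, and
it is the union of the pairwise disjoint sets `f_i(E)`. -/
def IsDustLike {d m : ℕ} (f : Fin m → EuclideanSpace ℝ (Fin d) → EuclideanSpace ℝ (Fin d))
    (E : Set (EuclideanSpace ℝ (Fin d))) : Prop :=
  E.Nonempty ∧ IsCompact E ∧ E = ⋃ i, f i '' E ∧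
    Pairwise fun i j => Disjoint (f i '' E) (f j '' E)

/-- The collection `𝒟(α)` of all dust-like self-similar sets in `ℝ^d` with contraction
vector `α`. -/
def dustLikeSets (d : ℕ) {m : ℕ} (α : Fin m → ℝ) : Set (Set (EuclideanSpace ℝ (Fin d))) :=
  {E | ∃ R b, IsDustLike (ifsMap α R b) E}

/-- `𝒟(α) ∼ 𝒟(β)`: some member of `𝒟(α)` is Lipschitz equivalent to some member of `𝒟(β)`. -/
def DustLipEquiv (d : ℕ) {m n : ℕ} (α : Fin m → ℝ) (β : Fin n → ℝ) : Prop :=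
  ∃ E ∈ dustLikeSets d α, ∃ F ∈ dustLikeSets d β, LipEquiv E F

/-- `f_w = f_{i_1} ∘ ⋯ ∘ f_{i_k}` for a finite word `w = i_1 ⋯ i_k`. -/
def wordMap {X : Type*} {m : ℕ} (f : Fin m → X → X) (w : List (Fin m)) : X → X :=
  w.foldr (fun i g => f i ∘ g) id

/-- `α_w = α_{i_1} ⋯ α_{i_k}` for a finite word `w = i_1 ⋯ i_k`. -/
def wordRatio {m : ℕ} (α : Fin m → ℝ) (w : List (Fin m)) : ℝ :=
  (w.map α).prod

/-- A set `Λ` of finite words is a partition for `E` if `E` is the disjoint union of the sets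
`f_w(E)`, `w ∈ Λ`. -/
def IsPartition {X : Type*} {m : ℕ} (f : Fin m → X → X) (E : Set X)
    (Λ : Set (List (Fin m))) : Prop :=
  E = ⋃ w ∈ Λ, wordMap f w '' E ∧ Λ.PairwiseDisjoint fun w => wordMap f w '' E

/-- `α` is derived from `β`: for some dust-like self-similar set `E ∈ 𝒟(β)` there is a partition
`Λ = {j_1, …, j_m}` with `α = (β_{j_1}, …, β_{j_m})`. -/
def IsDerivedFrom (d : ℕ) {m n : ℕ} (α : Fin m → ℝ) (β : Fin n → ℝ) : Prop :=
  IsContractionVector d α ∧ IsContractionVector d β ∧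
    ∃ R b, ∃ E : Set (EuclideanSpace ℝ (Fin d)), IsDustLike (ifsMap β R b) E ∧
      ∃ j : Fin m → List (Fin n), Function.Injective j ∧
        IsPartition (ifsMap β R b) E (Set.range j) ∧ ∀ i, α i = wordRatio β (j i)

/-- `α ∼ β`: there is a finite sequence of vectors from `α` to `β` (of varying lengths) in which,
of any two consecutive ones, one is derived from the other. -/
def VectorEquiv (d : ℕ) {m n : ℕ} (α : Fin m → ℝ) (β : Fin n → ℝ) : Prop :=
  Relation.ReflTransGen
    (fun u v : (k : ℕ) × (Fin k → ℝ) => IsDerivedFrom d v.2 u.2 ∨ IsDerivedFrom d u.2 v.2)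
    ⟨m, α⟩ ⟨n, β⟩

/-! Two dust-like sets with the same ratios are bi-Lipschitz equivalent: match points by address,
since a distance is, up to constants, the ratio of the last cylinder containing both points. A
derived vector shares a set with its source, so a chain of derivations gives equivalence of sets.

Conversely, let ψ : F → E be bi-Lipschitz, where E has m ≥ 2 pieces of ratio a. Each ψ(F_w) is a
union of N_w cylinders of level k_w, with N_w bounded and a^{k_w} comparable to β_w
(`exists_cylinder_counts`). Let a^s = 1/m. Then G_w = N_w m^{-k_w}, the natural measure of ψ(F_w),
is additive and comparable to β_w^s, and G_{wj}/G_w takes finitely many values. Near the supremum of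
G_w/β_w^s the density cannot jump up, so it is constant below some word
(`exists_proportional_word`). Hence β_j^s is rational, and pigeonhole on N makes one of its powers a
power of 1/m (`weights_of_counts`).

Write m = r^e with r not a proper power. Unique roots of integers force β_j^s = r^{-k_j}
(`eq_inv_pow_of_rational`), so β_j = ρ^{k_j} with ρ = a^{1/e} and ∑ r^{-k_j} = 1. By a Kraft
argument (`exists_words_of_kraft_sum`) both vectors are derived from (ρ, …, ρ) of length r; as rρ^d
< 1, a dust-like set for it exists (`exists_isDustLike_uniform`). -/

open Set

/-- A finite system of contracting similarities `f i` of ratios `α i` on a metric space, together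
with a nonempty compact set `E` which is the disjoint union of its images under the `f i`. -/
structure DustSystem {X : Type*} [MetricSpace X] {m : ℕ} (α : Fin m → ℝ) (f : Fin m → X → X)
    (E : Set X) : Prop where
  ratio_pos : ∀ i, 0 < α i
  ratio_lt_one : ∀ i, α i < 1
  dist_map : ∀ i x y, dist (f i x) (f i y) = α i * dist x y
  nonempty : E.Nonempty
  isCompact : IsCompact E
  eq_iUnion : E = ⋃ i, f i '' E
  disjoint : Pairwise fun i j => Disjoint (f i '' E) (f j '' E)

/-! ### Words and cylinders -/

section Words

variable {X : Type*} {m : ℕ}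

@[simp] lemma wordMap_nil (f : Fin m → X → X) : wordMap f [] = id := rfl

lemma wordMap_cons (f : Fin m → X → X) (i : Fin m) (w : List (Fin m)) :
    wordMap f (i :: w) = f i ∘ wordMap f w := rfl

lemma wordMap_append (f : Fin m → X → X) (u v : List (Fin m)) :
    wordMap f (u ++ v) = wordMap f u ∘ wordMap f v := by
  induction u with
  | nil => rfl
  | cons i u ih => rw [List.cons_append, wordMap_cons, ih, wordMap_cons]; rfl

@[simp] lemma wordMap_singleton (f : Fin m → X → X) (i : Fin m) : wordMap f [i] = f i := rfl

@[simp] lemma wordRatio_nil (α : Fin m → ℝ) : wordRatio α [] = 1 := rfl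

lemma wordRatio_cons (α : Fin m → ℝ) (i : Fin m) (w : List (Fin m)) :
    wordRatio α (i :: w) = α i * wordRatio α w := by simp [wordRatio]

lemma wordRatio_append (α : Fin m → ℝ) (u v : List (Fin m)) :
    wordRatio α (u ++ v) = wordRatio α u * wordRatio α v := by simp [wordRatio]

lemma wordRatio_concat (α : Fin m → ℝ) (u : List (Fin m)) (i : Fin m) :
    wordRatio α (u ++ [i]) = wordRatio α u * α i := by simp [wordRatio]

lemma wordRatio_const (a : ℝ) (w : List (Fin m)) :
    wordRatio (fun _ => a) w = a ^ w.length := by simp [wordRatio]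

lemma wordRatio_pos {α : Fin m → ℝ} (h : ∀ i, 0 < α i) (w : List (Fin m)) :
    0 < wordRatio α w := by
  induction w with
  | nil => simp
  | cons i w ih => rw [wordRatio_cons]; exact mul_pos (h i) ih

lemma wordRatio_le_one {α : Fin m → ℝ} (h : ∀ i, 0 < α i) (h1 : ∀ i, α i < 1)
    (w : List (Fin m)) : wordRatio α w ≤ 1 := by
  induction w with
  | nil => simp
  | cons i w ih =>
    rw [wordRatio_cons]
    exact mul_le_one₀ (h1 i).le (wordRatio_pos h w).le ih

/-- The cylinder `f_w(E)`. -/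
def cylinder (f : Fin m → X → X) (E : Set X) (w : List (Fin m)) : Set X := wordMap f w '' E

@[simp] lemma cylinder_nil (f : Fin m → X → X) (E : Set X) : cylinder f E [] = E := by
  simp [cylinder]

lemma cylinder_append (f : Fin m → X → X) (E : Set X) (u v : List (Fin m)) :
    cylinder f E (u ++ v) = wordMap f u '' cylinder f E v := by
  rw [cylinder, wordMap_append, image_comp, cylinder]

lemma cylinder_cons (f : Fin m → X → X) (E : Set X) (i : Fin m) (v : List (Fin m)) :
    cylinder f E (i :: v) = f i '' cylinder f E v := by
  rw [cylinder, wordMap_cons, image_comp, cylinder]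

end Words

/-! ### Diameters and gaps of cylinders -/

namespace DustSystem

variable {X : Type*} [MetricSpace X] {m : ℕ} {α : Fin m → ℝ} {f : Fin m → X → X} {E : Set X}

lemma word_pos (h : DustSystem α f E) (w : List (Fin m)) : 0 < wordRatio α w :=
  wordRatio_pos h.ratio_pos w

lemma dist_wordMap (h : DustSystem α f E) (w : List (Fin m)) (x y : X) :
    dist (wordMap f w x) (wordMap f w y) = wordRatio α w * dist x y := by
  induction w with
  | nil => simp
  | cons i w ih => simp [wordMap_cons, wordRatio_cons, h.dist_map, ih, mul_assoc]

lemma wordMap_injective (h : DustSystem α f E) (w : List (Fin m)) :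
    Function.Injective (wordMap f w) := fun x y hxy => by
  have := h.dist_wordMap w x y
  rw [hxy, dist_self] at this
  exact dist_eq_zero.1 ((mul_eq_zero.1 this.symm).resolve_left (h.word_pos w).ne')

lemma continuous_wordMap (h : DustSystem α f E) (w : List (Fin m)) :
    Continuous (wordMap f w) :=
  (LipschitzWith.of_dist_le_mul (K := ⟨wordRatio α w, (h.word_pos w).le⟩)
    fun x y => (h.dist_wordMap w x y).le).continuous

lemma cylinder_subset (h : DustSystem α f E) (w : List (Fin m)) : cylinder f E w ⊆ E := by
  induction w with
  | nil => simp
  | cons i w ih =>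
    rw [cylinder_cons]
    refine (image_mono ih).trans ?_
    conv_rhs => rw [h.eq_iUnion]
    exact subset_iUnion (fun i => f i '' E) i

lemma cylinder_nonempty (h : DustSystem α f E) (w : List (Fin m)) : (cylinder f E w).Nonempty :=
  h.nonempty.image _

lemma isCompact_cylinder (h : DustSystem α f E) (w : List (Fin m)) :
    IsCompact (cylinder f E w) := h.isCompact.image (h.continuous_wordMap w)

lemma cylinder_append_subset (h : DustSystem α f E) (u v : List (Fin m)) :
    cylinder f E (u ++ v) ⊆ cylinder f E u := by
  rw [cylinder_append]
  exact image_mono (h.cylinder_subset v)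

lemma cylinder_eq_iUnion (h : DustSystem α f E) (u : List (Fin m)) :
    cylinder f E u = ⋃ i, cylinder f E (u ++ [i]) := by
  simp only [cylinder_append]
  rw [← image_iUnion]
  simp only [cylinder, wordMap_singleton]
  rw [← h.eq_iUnion]

lemma exists_mem_concat (h : DustSystem α f E) {u : List (Fin m)} {x : X}
    (hx : x ∈ cylinder f E u) : ∃ i, x ∈ cylinder f E (u ++ [i]) := by
  rwa [h.cylinder_eq_iUnion, mem_iUnion] at hx

lemma disjoint_concat (h : DustSystem α f E) (u : List (Fin m)) {i j : Fin m} (hij : i ≠ j) :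
    Disjoint (cylinder f E (u ++ [i])) (cylinder f E (u ++ [j])) := by
  simp only [cylinder_append]
  rw [disjoint_image_iff (h.wordMap_injective u)]
  exact h.disjoint hij

/-- Words of equal length with intersecting cylinders coincide. -/
lemma eq_of_mem_of_mem (h : DustSystem α f E) {u v : List (Fin m)} (hl : u.length = v.length)
    {x : X} (hu : x ∈ cylinder f E u) (hv : x ∈ cylinder f E v) : u = v := by
  induction u using List.reverseRecOn generalizing v with
  | nil => simpa using hl.symm
  | append_singleton u i ih =>
    rcases List.eq_nil_or_concat' v with rfl | ⟨v, j, rfl⟩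
    · simp at hl
    · obtain rfl := ih (by simpa using hl) (h.cylinder_append_subset _ _ hu)
        (h.cylinder_append_subset _ _ hv)
      by_cases hij : i = j
      · rw [hij]
      · exact absurd hv (disjoint_left.1 (h.disjoint_concat u hij) hu)

lemma exists_word_of_length (h : DustSystem α f E) {x : X} (hx : x ∈ E) (k : ℕ) :
    ∃ u : List (Fin m), u.length = k ∧ x ∈ cylinder f E u := by
  induction k with
  | zero => exact ⟨[], rfl, by simpa⟩
  | succ k ih =>
    obtain ⟨u, hu, hxu⟩ := ih
    obtain ⟨i, hi⟩ := h.exists_mem_concat hxu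
    exact ⟨u ++ [i], by simp [hu], hi⟩

/-- Finitely many disjoint compact pieces have a positive mutual distance; scaling this gap along
words gives all lower distance bounds below. -/
lemma exists_separation (h : DustSystem α f E) :
    ∃ δ > 0, ∀ i, ∀ x ∈ f i '' E, ∀ y ∈ E, y ∉ f i '' E → δ ≤ dist x y := by
  have hc : ∀ i, IsCompact (f i '' E) := fun i => by
    simpa [cylinder] using h.isCompact_cylinder [i]
  have key : ∀ i j, ∃ δ > 0, i ≠ j → ∀ x ∈ f i '' E, ∀ y ∈ f j '' E, δ ≤ dist x y := by
    intro i j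
    by_cases hij : i = j
    · exact ⟨1, one_pos, fun hn => absurd hij hn⟩
    obtain ⟨δ, hδ, hd⟩ := (h.disjoint hij).exists_thickenings (hc i) (hc j).isClosed
    refine ⟨δ, hδ, fun _ x hx y hy => ?_⟩
    by_contra! hlt
    exact disjoint_left.1 hd (Metric.mem_thickening_iff.2 ⟨x, hx, by rwa [dist_comm]⟩)
      (Metric.self_subset_thickening hδ _ hy)
  choose δ hδ hsep using key
  obtain ⟨ε, hε, hle⟩ : ∃ ε > 0, ∀ i j, ε ≤ δ i j := by
    have : ∀ᶠ ε in nhdsWithin (0 : ℝ) (Ioi 0), ∀ i j, ε ≤ δ i j := by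
      simp only [Filter.eventually_all]
      intro i j
      exact nhdsWithin_le_nhds (Iic_mem_nhds (hδ i j))
    obtain ⟨ε, h1, h2⟩ := (this.and self_mem_nhdsWithin).exists
    exact ⟨ε, h2, h1⟩
  refine ⟨ε, hε, fun i x hx y hy hyi => ?_⟩
  rw [h.eq_iUnion, mem_iUnion] at hy
  obtain ⟨j, hj⟩ := hy
  have hij : i ≠ j := by rintro rfl; exact hyi hj
  exact (hle i j).trans (hsep i j hij x hx y hj)

lemma exists_dist_le (h : DustSystem α f E) : ∃ D > 0, ∀ x ∈ E, ∀ y ∈ E, dist x y ≤ D := by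
  obtain ⟨D, hD⟩ := Metric.isBounded_iff.1 h.isCompact.isBounded
  exact ⟨max D 1, by positivity, fun x hx y hy => (hD hx hy).trans (le_max_left _ _)⟩

lemma dist_le_of_mem_cylinder (h : DustSystem α f E) {D : ℝ}
    (hD : ∀ x ∈ E, ∀ y ∈ E, dist x y ≤ D) {w : List (Fin m)} {x y : X}
    (hx : x ∈ cylinder f E w) (hy : y ∈ cylinder f E w) : dist x y ≤ wordRatio α w * D := by
  obtain ⟨x, hx, rfl⟩ := hx
  obtain ⟨y, hy, rfl⟩ := hy
  rw [h.dist_wordMap]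
  exact mul_le_mul_of_nonneg_left (hD x hx y hy) (h.word_pos w).le

lemma le_dist_of_mem_concat (h : DustSystem α f E) {δ : ℝ}
    (hδ : ∀ i, ∀ x ∈ f i '' E, ∀ y ∈ E, y ∉ f i '' E → δ ≤ dist x y) {u : List (Fin m)}
    {i : Fin m} {x y : X} (hx : x ∈ cylinder f E (u ++ [i])) (hy : y ∈ cylinder f E u)
    (hyi : y ∉ cylinder f E (u ++ [i])) : wordRatio α u * δ ≤ dist x y := by
  rw [cylinder_append] at hx hyi
  obtain ⟨x, hx, rfl⟩ := hx
  obtain ⟨y, hy, rfl⟩ := hy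
  rw [h.dist_wordMap]
  exact mul_le_mul_of_nonneg_left (hδ i x hx y hy fun hy' => hyi ⟨y, hy', rfl⟩) (h.word_pos u).le

lemma le_dist_of_mem_cylinder (h : DustSystem α f E) {δ : ℝ} (hδ0 : 0 < δ)
    (hδ : ∀ i, ∀ x ∈ f i '' E, ∀ y ∈ E, y ∉ f i '' E → δ ≤ dist x y) {w : List (Fin m)}
    {x y : X} (hx : x ∈ cylinder f E w) (hy : y ∈ E) (hyw : y ∉ cylinder f E w) :
    wordRatio α w * δ ≤ dist x y := by
  induction w using List.reverseRecOn with
  | nil => exact absurd (by simpa using hy) hyw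
  | append_singleton u i ih =>
    have hle : wordRatio α (u ++ [i]) * δ ≤ wordRatio α u * δ := by
      rw [wordRatio_concat]
      have := mul_le_of_le_one_right (h.word_pos u).le (h.ratio_lt_one i).le
      exact mul_le_mul_of_nonneg_right this hδ0.le
    by_cases hyu : y ∈ cylinder f E u
    · exact hle.trans (h.le_dist_of_mem_concat hδ hx hyu hyw)
    · exact hle.trans (ih (h.cylinder_append_subset _ _ hx) hyu)

lemma exists_ratio_lt (h : DustSystem α f E) {ε : ℝ} (hε : 0 < ε) :
    ∃ k : ℕ, ∀ w : List (Fin m), w.length = k → wordRatio α w < ε := by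
  -- The largest ratio; 0 serves when there are no maps.
  obtain ⟨c, hc0, hc1, hc⟩ : ∃ c : ℝ, 0 ≤ c ∧ c < 1 ∧ ∀ i, α i ≤ c := by
    rcases isEmpty_or_nonempty (Fin m) with hm | hm
    · exact ⟨0, le_rfl, one_pos, fun i => isEmptyElim i⟩
    · obtain ⟨i, hi⟩ := Finite.exists_max α
      exact ⟨α i, (h.ratio_pos i).le, h.ratio_lt_one i, hi⟩
  obtain ⟨k, hk⟩ := exists_pow_lt_of_lt_one hε hc1
  refine ⟨k, fun w hw => lt_of_le_of_lt ?_ hk⟩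
  rw [← hw]
  clear hw
  induction w with
  | nil => simp
  | cons i w ih =>
    rw [wordRatio_cons, List.length_cons, pow_succ']
    exact mul_le_mul (hc i) ih (h.word_pos w).le hc0

/-- Distinct points are separated by a first cylinder. -/
lemma exists_separating_word (h : DustSystem α f E) {x y : X} (hx : x ∈ E) (hy : y ∈ E)
    (hxy : x ≠ y) : ∃ u i, x ∈ cylinder f E (u ++ [i]) ∧ y ∈ cylinder f E u ∧
      y ∉ cylinder f E (u ++ [i]) := by
  obtain ⟨D, hD0, hD⟩ := h.exists_dist_le
  obtain ⟨k, hk⟩ := h.exists_ratio_lt (div_pos (dist_pos.2 hxy) hD0)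
  obtain ⟨w, hw, hxw⟩ := h.exists_word_of_length hx k
  have hyw : y ∉ cylinder f E w := fun hyw => by
    have h1 := h.dist_le_of_mem_cylinder hD hxw hyw
    have h2 := (lt_div_iff₀ hD0).1 (hk w hw)
    linarith
  -- Shorten w letter by letter until its cylinder first contains y.
  clear hw hk
  induction w using List.reverseRecOn with
  | nil => exact absurd (by simpa using hy) hyw
  | append_singleton u i ih =>
    by_cases hyu : y ∈ cylinder f E u
    · exact ⟨u, i, hxw, hyu, hyw⟩
    · exact ih (h.cylinder_append_subset _ _ hxw) hyu

/-! ### The address map between sets with equal ratios -/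

section Transfer

variable {Y : Type*} [MetricSpace Y] {g : Fin m → Y → Y} {F : Set Y}

/-- Points of two dust-like sets have the same address. -/
def SameAddress (f : Fin m → X → X) (E : Set X) (g : Fin m → Y → Y) (F : Set Y) (x : X) (y : Y) :
    Prop := ∀ w, x ∈ cylinder f E w → y ∈ cylinder g F w

lemma sameAddress_symm (hE : DustSystem α f E) (hF : DustSystem α g F) {x : X} {y : Y}
    (hx : x ∈ E) (hxy : SameAddress f E g F x y) : SameAddress g F f E y x := by
  intro w hw
  obtain ⟨u, hu, hxu⟩ := hE.exists_word_of_length hx w.length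
  rwa [hF.eq_of_mem_of_mem hu.symm hw (hxy u hxu)]

/-- The address of x names a decreasing sequence of nonempty compact cylinders of F, which has a
common point. -/
lemma exists_sameAddress (hE : DustSystem α f E) (hF : DustSystem α g F) {x : X} (hx : x ∈ E) :
    ∃ y ∈ F, SameAddress f E g F x y := by
  choose u hu hxu using hE.exists_word_of_length hx
  have hstep : ∀ k, ∃ i, u (k + 1) = u k ++ [i] := fun k => by
    obtain ⟨i, hi⟩ := hE.exists_mem_concat (hxu k)
    exact ⟨i, hE.eq_of_mem_of_mem (by simp [hu]) (hxu (k + 1)) hi⟩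
  have hne := IsCompact.nonempty_iInter_of_sequence_nonempty_isCompact_isClosed
    (fun k => cylinder g F (u k))
    (fun k => by
      obtain ⟨i, hi⟩ := hstep k
      simp only [hi]
      exact hF.cylinder_append_subset _ _)
    (fun k => hF.cylinder_nonempty _) (hF.isCompact_cylinder _)
    (fun k => (hF.isCompact_cylinder _).isClosed)
  obtain ⟨y, hy⟩ := hne
  rw [mem_iInter] at hy
  refine ⟨y, hF.cylinder_subset _ (hy 0), fun w hw => ?_⟩
  rw [hE.eq_of_mem_of_mem (hu w.length).symm hw (hxu _)]
  exact hy _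

/-- At the word u where y and y' separate, their distance is at most D times the ratio of u, while x
and x' separate there too and lie at least δ times that same ratio apart. -/
lemma dist_le_of_sameAddress (hE : DustSystem α f E) (hF : DustSystem α g F) {δ D : ℝ}
    (hδ0 : 0 < δ) (hδ : ∀ i, ∀ x ∈ f i '' E, ∀ y ∈ E, y ∉ f i '' E → δ ≤ dist x y) (hD0 : 0 < D)
    (hD : ∀ x ∈ F, ∀ y ∈ F, dist x y ≤ D) {x x' : X} {y y' : Y} (hx : x ∈ E) (hx' : x' ∈ E)
    (hxy : SameAddress f E g F x y) (hxy' : SameAddress f E g F x' y') :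
    dist y y' ≤ D / δ * dist x x' := by
  have hyF : y ∈ F := by simpa using hxy [] (by simpa)
  have hyF' : y' ∈ F := by simpa using hxy' [] (by simpa)
  rcases eq_or_ne y y' with rfl | hne
  · rw [dist_self]; positivity
  obtain ⟨u, i, h1, h2, h3⟩ := hF.exists_separating_word hyF hyF' hne
  have s := sameAddress_symm hE hF hx hxy
  have s' := sameAddress_symm hE hF hx' hxy'
  have hd := hE.le_dist_of_mem_concat hδ (s _ h1) (s' _ h2) fun hc => h3 (hxy' _ hc)
  have hu := hF.dist_le_of_mem_cylinder hD (hF.cylinder_append_subset _ _ h1) h2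
  calc dist y y' ≤ wordRatio α u * D := hu
    _ = D / δ * (wordRatio α u * δ) := by field_simp
    _ ≤ _ := mul_le_mul_of_nonneg_left hd (by positivity)

/-- Dust-like sets with the same ratios are bi-Lipschitz equivalent. -/
lemma exists_biLipschitz (hE : DustSystem α f E) (hF : DustSystem α g F) :
    ∃ φ : E → F, Function.Bijective φ ∧ ∃ C : ℝ, 0 < C ∧
      ∀ x y : E, C⁻¹ * dist x y ≤ dist (φ x) (φ y) ∧ dist (φ x) (φ y) ≤ C * dist x y := by
  have hex : ∀ x : E, ∃ y : F, SameAddress f E g F x y := fun x => by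
    obtain ⟨y, hy, h⟩ := exists_sameAddress hE hF x.2
    exact ⟨⟨y, hy⟩, h⟩
  choose φ hφ using hex
  obtain ⟨δ, hδ0, hδ⟩ := hE.exists_separation
  obtain ⟨δ', hδ0', hδ'⟩ := hF.exists_separation
  obtain ⟨D, hD0, hD⟩ := hE.exists_dist_le
  obtain ⟨D', hD0', hD'⟩ := hF.exists_dist_le
  have up : ∀ x y : E, dist (φ x) (φ y) ≤ D' / δ * dist x y := fun x y =>
    dist_le_of_sameAddress hE hF hδ0 hδ hD0' hD' x.2 y.2 (hφ x) (hφ y)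
  have low : ∀ x y : E, dist x y ≤ D / δ' * dist (φ x) (φ y) := fun x y =>
    dist_le_of_sameAddress hF hE hδ0' hδ' hD0 hD (φ x).2 (φ y).2
      (sameAddress_symm hE hF x.2 (hφ x)) (sameAddress_symm hE hF y.2 (hφ y))
  refine ⟨φ, ⟨fun x y hxy => ?_, fun y => ?_⟩, max (D' / δ) (D / δ'), ?_, fun x y => ⟨?_, ?_⟩⟩
  · have := low x y
    rw [hxy, dist_self, mul_zero] at this
    exact dist_le_zero.1 this
  · obtain ⟨x, hx, hxy⟩ := exists_sameAddress hF hE y.2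
    refine ⟨⟨x, hx⟩, dist_le_zero.1 ?_⟩
    have := dist_le_of_sameAddress hE hF hδ0 hδ hD0' hD' hx hx (hφ ⟨x, hx⟩)
      (sameAddress_symm hF hE y.2 hxy)
    rw [dist_self, mul_zero] at this
    exact this
  · exact lt_max_of_lt_left (by positivity)
  · have hC : 0 < max (D' / δ) (D / δ') := lt_max_of_lt_left (by positivity)
    rw [inv_mul_le_iff₀ hC]
    exact (low x y).trans (mul_le_mul_of_nonneg_right (le_max_right _ _) dist_nonneg)
  · exact (up x y).trans (mul_le_mul_of_nonneg_right (le_max_left _ _) dist_nonneg)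

end Transfer

end DustSystem

/-! ### Counting cylinders inside a set -/

section Counting

variable {X : Type*} {m : ℕ}

open Classical in
/-- The number of words `v` of length `k` with `f_{uv}(e) ∈ A`. -/
noncomputable def wordCount (f : Fin m → X → X) (e : X) (A : Set X) : ℕ → List (Fin m) → ℕ
  | 0, u => if wordMap f u e ∈ A then 1 else 0
  | k + 1, u => ∑ i, wordCount f e A k (u ++ [i])

lemma wordCount_iUnion (f : Fin m → X → X) (e : X) {ι : Type*} [Fintype ι] {A : ι → Set X}
    (hA : Pairwise fun i j => Disjoint (A i) (A j)) (k : ℕ) (u : List (Fin m)) :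
    wordCount f e (⋃ i, A i) k u = ∑ i, wordCount f e (A i) k u := by
  classical
  induction k generalizing u with
  | zero =>
    simp only [wordCount, mem_iUnion]
    split_ifs with h
    · obtain ⟨i, hi⟩ := h
      rw [Finset.sum_eq_single i, if_pos hi]
      · intro j _ hj
        exact if_neg fun hj' => disjoint_left.1 (hA hj) hj' hi
      · simp
    · symm
      refine Finset.sum_eq_zero fun i _ => if_neg fun hi => h ⟨i, hi⟩
  | succ k ih =>
    simp only [wordCount, ih]
    exact Finset.sum_comm

/-- `A` is a union of cylinders of level `k`. -/
def IsResolved (f : Fin m → X → X) (E A : Set X) (k : ℕ) : Prop :=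
  ∀ u : List (Fin m), u.length = k → ∀ x ∈ cylinder f E u, ∀ y ∈ cylinder f E u, x ∈ A → y ∈ A

lemma mem_cylinder_self {f : Fin m → X → X} {E : Set X} {e : X} (he : e ∈ E) (u : List (Fin m)) :
    wordMap f u e ∈ cylinder f E u := ⟨e, he, rfl⟩

lemma wordCount_le (f : Fin m → X → X) (e : X) (A : Set X) (k : ℕ) (u : List (Fin m)) :
    wordCount f e A k u ≤ m ^ k := by
  induction k generalizing u with
  | zero => simp only [wordCount]; split_ifs <;> simp
  | succ k ih =>
    rw [wordCount]
    refine (Finset.sum_le_sum fun i _ => ih (u ++ [i])).trans ?_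
    simp [pow_succ']

end Counting

namespace DustSystem

variable {X : Type*} [MetricSpace X] {m : ℕ} {α : Fin m → ℝ} {f : Fin m → X → X} {E A : Set X}

lemma isResolved_mono (h : DustSystem α f E) {k l : ℕ} (hkl : k ≤ l) (hA : IsResolved f E A k) :
    IsResolved f E A l := by
  intro u hu x hx y hy
  rw [← List.take_append_drop k u] at hx hy
  exact hA (u.take k) (by simp [hu, hkl]) x (h.cylinder_append_subset _ _ hx) y
    (h.cylinder_append_subset _ _ hy)

/-- Once A is resolved, the m children of a cylinder all lie in A or all miss it, so one more level
multiplies the count by m. Thus count times m^{-level} stabilises and plays the role of a measure.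
-/
lemma wordCount_succ (h : DustSystem α f E) {e : X} (he : e ∈ E) {k : ℕ} {u : List (Fin m)}
    (hA : IsResolved f E A (u.length + k)) :
    wordCount f e A (k + 1) u = m * wordCount f e A k u := by
  induction k generalizing u with
  | zero =>
    have key : ∀ i, wordMap f (u ++ [i]) e ∈ A ↔ wordMap f u e ∈ A := fun i => by
      have h1 := h.cylinder_append_subset u [i] (mem_cylinder_self he (u ++ [i]))
      have h2 := mem_cylinder_self (f := f) he u
      exact ⟨hA u rfl _ h1 _ h2, hA u rfl _ h2 _ h1⟩
    by_cases hu : wordMap f u e ∈ A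
    · simp [wordCount, hu, fun i => (key i).2 hu]
    · simp [wordCount, hu, fun i => mt (key i).1 hu]
  | succ k ih =>
    rw [wordCount, wordCount, Finset.mul_sum]
    refine Finset.sum_congr rfl fun i _ => ih ?_
    simpa [add_assoc, add_comm 1] using hA

lemma wordCount_add (h : DustSystem α f E) {e : X} (he : e ∈ E) {k : ℕ}
    (hA : IsResolved f E A k) (l : ℕ) :
    wordCount f e A (k + l) [] = m ^ l * wordCount f e A k [] := by
  induction l with
  | zero => simp
  | succ l ih =>
    rw [← add_assoc, h.wordCount_succ he (by simpa using h.isResolved_mono (by omega) hA), ih,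
      pow_succ]
    ring

lemma one_le_wordCount (h : DustSystem α f E) {e : X} (he : e ∈ E) {k : ℕ} {u : List (Fin m)}
    (hA : IsResolved f E A (u.length + k)) {z : X} (hz : z ∈ A) (hzu : z ∈ cylinder f E u) :
    1 ≤ wordCount f e A k u := by
  induction k generalizing u with
  | zero =>
    have := hA u rfl z hzu _ (mem_cylinder_self he u) hz
    simp [wordCount, this]
  | succ k ih =>
    obtain ⟨i, hi⟩ := h.exists_mem_concat hzu
    refine (ih (by simpa [add_assoc, add_comm 1] using hA) hi).trans ?_
    rw [wordCount]
    exact Finset.single_le_sum (f := fun i => wordCount f e A k (u ++ [i]))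
      (fun _ _ => Nat.zero_le _) (Finset.mem_univ i)

lemma wordCount_eq_zero (h : DustSystem α f E) {e : X} (he : e ∈ E) {k : ℕ} {u : List (Fin m)}
    (hA : Disjoint A (cylinder f E u)) : wordCount f e A k u = 0 := by
  induction k generalizing u with
  | zero =>
    simp only [wordCount]
    exact if_neg fun hu => disjoint_left.1 hA hu (mem_cylinder_self he u)
  | succ k ih =>
    rw [wordCount]
    exact Finset.sum_eq_zero fun i _ => ih (hA.mono_right (h.cylinder_append_subset _ _))

/-- Along the letters of v only one child meets A, so branching is confined to the last l levels. -/
lemma wordCount_le_of_subset (h : DustSystem α f E) {e : X} (he : e ∈ E) {l : ℕ}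
    {u v : List (Fin m)} (hA : A ⊆ cylinder f E (u ++ v)) :
    wordCount f e A (v.length + l) u ≤ m ^ l := by
  induction v generalizing u with
  | nil => simpa using wordCount_le f e A l u
  | cons j v ih =>
    have hlen : (j :: v).length + l = (v.length + l) + 1 := by simp; omega
    have hA' : A ⊆ cylinder f E ((u ++ [j]) ++ v) := by simpa using hA
    rw [hlen, wordCount, Finset.sum_eq_single j]
    · exact ih hA'
    · intro i _ hij
      refine h.wordCount_eq_zero he ((h.disjoint_concat u hij.symm).mono_left ?_)
      exact hA'.trans (h.cylinder_append_subset _ _)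
    · simp

/-- Images of the cylinders of a dust-like set `F` under a bi-Lipschitz bijection onto a dust-like
set `E` of uniform ratio `a`: each consists of a bounded number of cylinders of `E` of comparable
size. -/
lemma exists_cylinder_counts {Y : Type*} [MetricSpace Y] {n : ℕ} {a : ℝ} {β : Fin n → ℝ}
    {g : Fin n → Y → Y} {F : Set Y} (hE : DustSystem (fun _ : Fin m => a) f E)
    (hF : DustSystem β g F) (ha0 : 0 < a) (ha1 : a < 1) (hm : 1 ≤ m) {ψ : F → E}
    (hψ : Function.Bijective ψ) {C : ℝ} (hC : 0 < C)
    (hlip : ∀ x y : F, C⁻¹ * dist x y ≤ dist (ψ x) (ψ y) ∧ dist (ψ x) (ψ y) ≤ C * dist x y) :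
    ∃ (N k : List (Fin n) → ℕ) (M : ℕ) (B : ℝ), 0 < B ∧ (∀ w, 1 ≤ N w ∧ N w ≤ M) ∧
      (∀ w, wordRatio β w ≤ B * a ^ k w ∧ a ^ k w ≤ B * wordRatio β w) ∧
      ∀ w, (N w : ℝ) * (m : ℝ)⁻¹ ^ k w =
        ∑ j, (N (w ++ [j]) : ℝ) * (m : ℝ)⁻¹ ^ k (w ++ [j]) := by
  obtain ⟨δ, hδ0, hδ⟩ := hE.exists_separation
  obtain ⟨δ', hδ0', hδ'⟩ := hF.exists_separation
  obtain ⟨D, hD0, hD⟩ := hE.exists_dist_le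
  obtain ⟨D', hD0', hD'⟩ := hF.exists_dist_le
  obtain ⟨e, he⟩ := hE.nonempty
  -- The image ψ(F_w), seen in X.
  let A : List (Fin n) → Set X := fun w => {x | ∃ y : F, (y : Y) ∈ cylinder g F w ∧ (ψ y : X) = x}
  -- A cylinder of E of ratio below θβ_w pulls back to a set of diameter less than β_w δ', the gap
  -- around F_w. So it cannot straddle the boundary of ψ(F_w), which is therefore resolved at level
  -- κ w + 1.
  obtain ⟨θ, hθ0, hθ1, hθ⟩ : ∃ θ : ℝ, 0 < θ ∧ θ ≤ 1 ∧ C * D * θ ≤ δ' := by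
    refine ⟨min 1 (δ' / (C * D)), lt_min one_pos (by positivity), min_le_left _ _, ?_⟩
    calc C * D * min 1 (δ' / (C * D)) ≤ C * D * (δ' / (C * D)) := by
          gcongr; exact min_le_right _ _
      _ = δ' := by field_simp
  have hk : ∀ w : List (Fin n), ∃ k : ℕ, a ^ (k + 1) < θ * wordRatio β w ∧
      θ * wordRatio β w ≤ a ^ k := fun w =>
    exists_nat_pow_near_of_lt_one (mul_pos hθ0 (hF.word_pos w))
      (mul_le_one₀ hθ1 (hF.word_pos w).le
        (wordRatio_le_one hF.ratio_pos hF.ratio_lt_one w)) ha0 ha1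
  choose κ hκ1 hκ2 using hk
  have hres : ∀ w k, κ w + 1 ≤ k → IsResolved f E (A w) k := by
    intro w k hwk
    refine hE.isResolved_mono hwk ?_
    rintro u hu x hx y hy ⟨x', hx', rfl⟩
    obtain ⟨y', hy'⟩ := hψ.2 ⟨y, hE.cylinder_subset _ hy⟩
    refine ⟨y', ?_, by rw [hy']⟩
    by_contra hcon
    have h1 := hF.le_dist_of_mem_cylinder hδ0' hδ' hx' y'.2 hcon
    have h2 := hE.dist_le_of_mem_cylinder hD hx hy
    have h3 := (hlip x' y').1
    rw [hy', inv_mul_le_iff₀ hC] at h3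
    rw [wordRatio_const, hu] at h2
    have h4 : dist (x' : Y) y' ≤ C * (a ^ (κ w + 1) * D) :=
      h3.trans (mul_le_mul_of_nonneg_left h2 hC.le)
    have h5 : C * (a ^ (κ w + 1) * D) < C * (θ * wordRatio β w * D) := by
      gcongr; exact hκ1 w
    have h6 : C * (θ * wordRatio β w * D) ≤ wordRatio β w * δ' := by
      calc C * (θ * wordRatio β w * D) = wordRatio β w * (C * D * θ) := by ring
        _ ≤ _ := mul_le_mul_of_nonneg_left hθ (hF.word_pos w).le
    linarith
  have hne : ∀ w, ∃ z ∈ A w, z ∈ E := fun w => by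
    obtain ⟨y, hy⟩ := hF.cylinder_nonempty w
    exact ⟨ψ ⟨y, hF.cylinder_subset _ hy⟩, ⟨_, hy, rfl⟩, Subtype.coe_prop _⟩
  -- Going up l levels suffices: ψ(F_w) has diameter at most C β_w D', less than the gap around a
  -- cylinder of level κ w + 1 - l, so it lies in one such cylinder and the count is at most m^l.
  obtain ⟨l, hl⟩ := exists_pow_lt_of_lt_one (show 0 < δ * θ * a / (C * D') by positivity) ha1
  have hbound : ∀ w, wordCount f e (A w) (κ w + 1) [] ≤ m ^ l := by
    intro w
    rcases le_total (κ w + 1) l with hle | hle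
    · exact (wordCount_le f e _ _ _).trans (Nat.pow_le_pow_right hm hle)
    obtain ⟨p, hp⟩ := Nat.exists_eq_add_of_le' hle
    obtain ⟨z, ⟨z', hz', hzz⟩, hzE⟩ := hne w
    obtain ⟨v, hv, hzv⟩ := hE.exists_word_of_length hzE p
    rw [hp, ← hv]
    refine hE.wordCount_le_of_subset he (u := []) ?_
    rintro y ⟨y', hy', rfl⟩
    rw [List.nil_append]
    by_contra hcon
    have h1 := hE.le_dist_of_mem_cylinder hδ0 hδ hzv (ψ y').2 hcon
    have h2 := hF.dist_le_of_mem_cylinder hD' hz' hy'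
    have h3 := (hlip z' y').2
    rw [wordRatio_const, hv, ← hzz] at h1
    have h4 : a ^ p * δ ≤ C * (wordRatio β w * D') :=
      h1.trans (h3.trans (mul_le_mul_of_nonneg_left h2 hC.le))
    have h5 : θ * wordRatio β w * a ≤ a ^ p * a ^ l := by
      rw [← pow_add, ← hp, pow_succ]
      exact mul_le_mul_of_nonneg_right (hκ2 w) ha0.le
    have h6 : a ^ l * (C * D') < δ * θ * a := (lt_div_iff₀ (by positivity)).1 hl
    have h7 : θ * a * (a ^ p * δ) ≤ a ^ p * a ^ l * (C * D') := by
      calc θ * a * (a ^ p * δ) ≤ θ * a * (C * (wordRatio β w * D')) := by gcongr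
        _ = θ * wordRatio β w * a * (C * D') := by ring
        _ ≤ _ := by gcongr
    have h8 : a ^ p * (a ^ l * (C * D')) < a ^ p * (δ * θ * a) := by gcongr
    linarith
  have hm0 : (m : ℝ) ≠ 0 := by positivity
  have hval : ∀ w k, κ w + 1 ≤ k → (wordCount f e (A w) (κ w + 1) [] : ℝ) * (m : ℝ)⁻¹ ^ (κ w + 1) =
      wordCount f e (A w) k [] * (m : ℝ)⁻¹ ^ k := by
    intro w k hwk
    obtain ⟨p, rfl⟩ := Nat.exists_eq_add_of_le hwk
    rw [hE.wordCount_add he (hres w _ le_rfl), pow_add _ _ p]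
    push_cast
    rw [inv_pow _ p]
    field_simp
  have hunion : ∀ w, A w = ⋃ j, A (w ++ [j]) := by
    intro w
    ext x
    simp only [A, mem_ofPred_eq, mem_iUnion]
    constructor
    · rintro ⟨y, hy, rfl⟩
      obtain ⟨j, hj⟩ := hF.exists_mem_concat hy
      exact ⟨j, y, hj, rfl⟩
    · rintro ⟨j, y, hy, rfl⟩
      exact ⟨y, hF.cylinder_append_subset _ _ hy, rfl⟩
  have hdisj : ∀ w, Pairwise fun i j => Disjoint (A (w ++ [i])) (A (w ++ [j])) := by
    intro w i j hij
    refine disjoint_left.2 ?_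
    rintro _ ⟨y, hy, rfl⟩ ⟨y', hy', heq⟩
    obtain rfl := hψ.1 (Subtype.ext heq)
    exact disjoint_left.1 (hF.disjoint_concat w hij) hy hy'
  refine ⟨fun w => wordCount f e (A w) (κ w + 1) [], fun w => κ w + 1, m ^ l,
    max (1 / (θ * a)) θ, lt_max_of_lt_right hθ0, fun w => ⟨?_, hbound w⟩, fun w => ⟨?_, ?_⟩,
    fun w => ?_⟩
  · obtain ⟨z, hz, hzE⟩ := hne w
    exact hE.one_le_wordCount he (by simpa using hres w _ le_rfl) hz (by simpa)
  · calc wordRatio β w = 1 / (θ * a) * (θ * wordRatio β w * a) := by field_simp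
      _ ≤ 1 / (θ * a) * (a ^ κ w * a) := by gcongr; exact hκ2 w
      _ ≤ _ := by rw [← pow_succ]; gcongr; exact le_max_left _ _
  · exact (hκ1 w).le.trans (mul_le_mul_of_nonneg_right (le_max_right _ _) (hF.word_pos w).le)
  -- A common level at which the images of F_w and of all its children are resolved.
  · let K := κ w + 1 + ∑ j, (κ (w ++ [j]) + 1)
    have hK : ∀ j, κ (w ++ [j]) + 1 ≤ K := fun j =>
      (Finset.single_le_sum (f := fun j => κ (w ++ [j]) + 1) (fun _ _ => Nat.zero_le _)
        (Finset.mem_univ j)).trans (Nat.le_add_left _ _)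
    simp only
    rw [hval w K (Nat.le_add_right _ _), Finset.sum_congr rfl fun j _ => hval (w ++ [j]) K (hK j),
      ← Finset.sum_mul, hunion w, wordCount_iUnion f e (hdisj w)]
    push_cast
    rfl

end DustSystem

/-! ### Rigidity of the weights -/

/-- A function on words comparable with the multiplicative weights `b_w` and additive under
refinement has total weight `∑ b_j = 1`; if moreover the relative growth takes finitely many values,
it is proportional to the weights below some word. -/
lemma exists_proportional_word {n : ℕ} {b : Fin n → ℝ} (hb : ∀ j, 0 < b j)
    {G : List (Fin n) → ℝ} {B : ℝ} (hB : 0 < B) (hG0 : ∀ w, 0 < G w)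
    (hup : ∀ w, G w ≤ B * wordRatio b w) (hlow : ∀ w, wordRatio b w ≤ B * G w)
    (hadd : ∀ w, G w = ∑ j, G (w ++ [j]))
    (hfin : (range fun p : List (Fin n) × Fin n => G (p.1 ++ [p.2]) / G p.1).Finite) :
    ∑ j, b j = 1 ∧ ∃ w, ∀ v, G (w ++ v) = wordRatio b v * G w := by
  have hw0 : ∀ w, 0 < wordRatio b w := wordRatio_pos hb
  -- The density of G against b; additivity says that J w is the b-weighted sum of its values at the
  -- children.
  let J : List (Fin n) → ℝ := fun w => G w / wordRatio b w
  have hJ0 : ∀ w, 0 < J w := fun w => div_pos (hG0 w) (hw0 w)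
  have hJup : ∀ w, J w ≤ B := fun w => (div_le_iff₀ (hw0 w)).2 (hup w)
  have hJlow : ∀ w, B⁻¹ ≤ J w := fun w => by
    rw [le_div_iff₀ (hw0 w), inv_mul_le_iff₀ hB]
    exact hlow w
  have hJadd : ∀ w, J w = ∑ j, b j * J (w ++ [j]) := fun w => by
    simp only [J]
    rw [hadd w, Finset.sum_div]
    refine Finset.sum_congr rfl fun j _ => ?_
    rw [wordRatio_concat]
    have := (hb j).ne'
    have := (hw0 w).ne'
    field_simp
  have hbdd : BddAbove (range J) := ⟨B, by rintro _ ⟨w, rfl⟩; exact hJup w⟩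
  have hbddb : BddBelow (range J) := ⟨B⁻¹, by rintro _ ⟨w, rfl⟩; exact hJlow w⟩
  set S := ⨆ w, J w with hS
  set I := ⨅ w, J w with hI
  have hS0 : 0 < S := (hJ0 []).trans_le (le_ciSup hbdd [])
  have hI0 : 0 < I := (inv_pos.2 hB).trans_le (le_ciInf hJlow)
  -- The infimum and supremum of J are positive and finite; applying the sum rule to each gives one
  -- of the two inequalities.
  have hsum : ∑ j, b j = 1 := by
    apply le_antisymm
    · have : (∑ j, b j) * I ≤ I := le_ciInf fun w => by
        rw [hJadd w, Finset.sum_mul]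
        exact Finset.sum_le_sum fun j _ =>
          mul_le_mul_of_nonneg_left (ciInf_le hbddb _) (hb j).le
      exact (mul_le_iff_le_one_left hI0).1 this
    · have : S ≤ (∑ j, b j) * S := ciSup_le fun w => by
        rw [hJadd w, Finset.sum_mul]
        exact Finset.sum_le_sum fun j _ =>
          mul_le_mul_of_nonneg_left (le_ciSup hbdd _) (hb j).le
      exact (le_mul_iff_one_le_left hS0).1 this
  refine ⟨hsum, ?_⟩
  have hfin' : (range fun p : List (Fin n) × Fin n => J (p.1 ++ [p.2]) / J p.1).Finite := by
    refine ((hfin.prod (finite_range b)).image fun q => q.1 / q.2).subset ?_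
    rintro _ ⟨⟨w, j⟩, rfl⟩
    refine ⟨(G (w ++ [j]) / G w, b j), ⟨⟨(w, j), rfl⟩, ⟨j, rfl⟩⟩, ?_⟩
    simp only [J]
    rw [wordRatio_concat]
    have := (hb j).ne'
    have := (hw0 w).ne'
    have := (hG0 w).ne'
    field_simp
  -- Finitely many growth factors leave a gap above 1.
  obtain ⟨ε, hε, hgap⟩ : ∃ ε > 0, ∀ w j, J w < J (w ++ [j]) → (1 + ε) * J w < J (w ++ [j]) := by
    have hev : ∀ᶠ ε in nhdsWithin (0 : ℝ) (Ioi 0),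
        ∀ q ∈ range (fun p : List (Fin n) × Fin n => J (p.1 ++ [p.2]) / J p.1),
          1 < q → 1 + ε < q := by
      rw [Filter.eventually_all_finite hfin']
      intro q _
      by_cases hq : 1 < q
      · filter_upwards [nhdsWithin_le_nhds (Iio_mem_nhds (sub_pos.2 hq))] with ε hε _
        have : ε < q - 1 := hε
        linarith
      · exact Filter.Eventually.of_forall fun _ h => absurd h hq
    obtain ⟨ε, h1, h2⟩ := (hev.and self_mem_nhdsWithin).exists
    refine ⟨ε, h2, fun w j hlt => ?_⟩
    rw [← lt_div_iff₀ (hJ0 w)]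
    exact h1 _ ⟨(w, j), rfl⟩ ((one_lt_div (hJ0 w)).2 hlt)
  have h1ε : 0 < 1 + ε := by linarith
  -- From here an increase would exceed S. So no child exceeds its parent, and since the parent is
  -- their weighted average all are equal.
  obtain ⟨w, hw⟩ : ∃ w, S / (1 + ε) < J w :=
    exists_lt_of_lt_ciSup (div_lt_self hS0 (by linarith))
  have hconst : ∀ v, J (w ++ v) = J w := by
    intro v
    induction v using List.reverseRecOn with
    | nil => simp
    | append_singleton v j ih =>
      have hle : ∀ i, J (w ++ v ++ [i]) ≤ J (w ++ v) := fun i => by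
        by_contra! hlt
        have h1 := hgap _ _ hlt
        rw [ih] at h1
        have h2 := (div_lt_iff₀ h1ε).1 hw
        have h3 := le_ciSup hbdd (w ++ v ++ [i])
        linarith
      have hs : ∑ i, b i * J (w ++ v ++ [i]) = ∑ i, b i * J (w ++ v) := by
        rw [← hJadd, ← Finset.sum_mul, hsum, one_mul]
      have := (Finset.sum_eq_sum_iff_of_le fun i _ =>
        mul_le_mul_of_nonneg_left (hle i) (hb i).le).1 hs j (Finset.mem_univ j)
      rw [← List.append_assoc, mul_left_cancel₀ (hb j).ne' this, ih]
  refine ⟨w, fun v => ?_⟩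
  have := hconst v
  simp only [J] at this
  rw [div_eq_div_iff (hw0 _).ne' (hw0 _).ne', wordRatio_append] at this
  have h0 := (hw0 w).ne'
  apply mul_right_cancel₀ h0
  linarith

/-- If boundedly many multiples of powers of `1/m` model the weights `b_w`, then the `b_j` sum to `1`,
are rational, and have a power that is a power of `1/m`. -/
lemma weights_of_counts {m n : ℕ} (hm : 2 ≤ m) {b : Fin n → ℝ} (hb : ∀ j, 0 < b j)
    {N k : List (Fin n) → ℕ} {M : ℕ} {B : ℝ} (hB : 0 < B) (hN : ∀ w, 1 ≤ N w ∧ N w ≤ M)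
    (hk : ∀ w, wordRatio b w ≤ B * (m : ℝ)⁻¹ ^ k w ∧ (m : ℝ)⁻¹ ^ k w ≤ B * wordRatio b w)
    (hadd : ∀ w, (N w : ℝ) * (m : ℝ)⁻¹ ^ k w =
        ∑ j, (N (w ++ [j]) : ℝ) * (m : ℝ)⁻¹ ^ k (w ++ [j])) :
    ∑ j, b j = 1 ∧ ∀ j, (∃ q : ℚ, (q : ℝ) = b j) ∧
      ∃ p l l' : ℕ, 0 < p ∧ b j ^ p * (m : ℝ)⁻¹ ^ l = (m : ℝ)⁻¹ ^ l' := by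
  set t : ℝ := (m : ℝ)⁻¹ with ht
  have hm2 : (2 : ℝ) ≤ m := by exact_mod_cast hm
  have ht0 : 0 < t := by positivity
  have ht1 : t < 1 := inv_lt_one_of_one_lt₀ (by linarith)
  have hw0 : ∀ w, 0 < wordRatio b w := wordRatio_pos hb
  have hN1 : ∀ w, (1 : ℝ) ≤ N w := fun w => by exact_mod_cast (hN w).1
  have hNM : ∀ w, (N w : ℝ) ≤ M := fun w => by exact_mod_cast (hN w).2
  have hM : (1 : ℝ) ≤ M := (hN1 []).trans (hNM [])
  -- N is bounded, and one letter changes the level k by at most a fixed K, because b_{wj}/b_w is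
  -- b_j.
  have hfin : (range fun p : List (Fin n) × Fin n =>
      (N (p.1 ++ [p.2]) * t ^ k (p.1 ++ [p.2])) / (N p.1 * t ^ k p.1)).Finite := by
    obtain ⟨H, hH0, hH⟩ : ∃ H : ℝ, 0 < H ∧ ∀ j, B ^ 2 / b j ≤ H ∧ B ^ 2 * b j ≤ H := by
      refine ⟨1 + ∑ j, (B ^ 2 / b j + B ^ 2 * b j), ?_, fun j => ?_⟩
      · have : 0 ≤ ∑ j, (B ^ 2 / b j + B ^ 2 * b j) :=
          Finset.sum_nonneg fun j _ => by have := hb j; positivity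
        linarith
      · have := Finset.single_le_sum (f := fun j => B ^ 2 / b j + B ^ 2 * b j)
          (fun j _ => by have := hb j; positivity) (Finset.mem_univ j)
        have h1 : 0 < B ^ 2 / b j := by have := hb j; positivity
        have h2 : 0 < B ^ 2 * b j := by have := hb j; positivity
        constructor <;> linarith
    obtain ⟨K, hK⟩ := exists_pow_lt_of_lt_one (inv_pos.2 hH0) ht1
    have hK' : t ^ K * H < 1 := by rwa [← lt_div_iff₀ hH0, one_div]
    have aux : ∀ x y : ℕ, t ^ x ≤ H * t ^ y → y ≤ x + K := by
      intro x y hxy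
      by_contra! hlt
      have h1 : t ^ y ≤ t ^ (x + K) := pow_le_pow_of_le_one ht0.le ht1.le hlt.le
      have h2 : H * t ^ y ≤ t ^ x * (t ^ K * H) := by
        calc H * t ^ y ≤ H * t ^ (x + K) := by gcongr
          _ = _ := by rw [pow_add]; ring
      have h3 : t ^ x * (t ^ K * H) < t ^ x * 1 := by gcongr
      linarith
    refine ((((finite_Iic M).prod (finite_Iic M)).prod
      ((finite_Iic K).prod (finite_Iic K))).image
        fun q : (ℕ × ℕ) × (ℕ × ℕ) => ((q.1.1 : ℝ) * t ^ q.2.1) / (q.1.2 * t ^ q.2.2)).subset ?_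
    rintro _ ⟨⟨w, j⟩, rfl⟩
    have h1 : k (w ++ [j]) ≤ k w + K := by
      apply aux
      calc t ^ k w ≤ B * wordRatio b w := (hk w).2
        _ = B / b j * wordRatio b (w ++ [j]) := by
            rw [wordRatio_concat]; have := (hb j).ne'; field_simp
        _ ≤ B / b j * (B * t ^ k (w ++ [j])) := by
            have := hb j; gcongr; exact (hk _).1
        _ = B ^ 2 / b j * t ^ k (w ++ [j]) := by ring
        _ ≤ _ := by gcongr; exact (hH j).1
    have h2 : k w ≤ k (w ++ [j]) + K := by
      apply aux
      calc t ^ k (w ++ [j]) ≤ B * wordRatio b (w ++ [j]) := (hk _).2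
        _ = B * b j * wordRatio b w := by rw [wordRatio_concat]; ring
        _ ≤ B * b j * (B * t ^ k w) := by
            have := hb j; gcongr; exact (hk _).1
        _ = B ^ 2 * b j * t ^ k w := by ring
        _ ≤ _ := by gcongr; exact (hH j).2
    -- With truncated subtraction one of the two differences is 0; the pair encodes the signed
    -- change of level.
    refine ⟨((N (w ++ [j]), N w), (k (w ++ [j]) - k w, k w - k (w ++ [j]))),
      ⟨⟨(hN _).2, (hN _).2⟩, ⟨?_, ?_⟩⟩, ?_⟩
    · simp only [mem_Iic]; omega
    · simp only [mem_Iic]; omega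
    · have hNw : (N w : ℝ) ≠ 0 := by have := hN1 w; positivity
      simp only
      rw [div_eq_div_iff (by positivity) (by positivity)]
      have : t ^ (k (w ++ [j]) - k w) * t ^ k w = t ^ k (w ++ [j]) * t ^ (k w - k (w ++ [j])) := by
        rw [← pow_add, ← pow_add]; congr 1; omega
      linear_combination (N (w ++ [j]) : ℝ) * N w * this
  obtain ⟨hsum, w, hw⟩ := exists_proportional_word hb (G := fun w => N w * t ^ k w)
    (B := M * B) (by positivity)
    (fun w => by have := hN1 w; positivity)
    (fun w => by
      have := hw0 w
      calc (N w : ℝ) * t ^ k w ≤ M * (B * wordRatio b w) :=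
            mul_le_mul (hNM w) (hk w).2 (by positivity) (by positivity)
        _ = _ := by ring)
    (fun w => by
      have h1 : B * t ^ k w ≤ M * B * (N w * t ^ k w) := by
        have : (1 : ℝ) ≤ M * N w := one_le_mul_of_one_le_of_one_le hM (hN1 w)
        calc B * t ^ k w = 1 * (B * t ^ k w) := by ring
          _ ≤ M * N w * (B * t ^ k w) := by gcongr
          _ = _ := by ring
      exact (hk w).1.trans h1)
    hadd hfin
  refine ⟨hsum, fun j => ?_⟩
  have hNw : (N w : ℝ) ≠ 0 := by have := hN1 w; positivity
  have hpow : ∀ p, (N (w ++ List.replicate p j) : ℝ) * t ^ k (w ++ List.replicate p j) =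
      b j ^ p * (N w * t ^ k w) := fun p => by
    have := hw (List.replicate p j)
    simpa [wordRatio] using this
  constructor
  · have h1 := hpow 1
    rw [pow_one, ← div_eq_iff (by positivity)] at h1
    refine ⟨(N (w ++ List.replicate 1 j) * (m : ℚ)⁻¹ ^ k (w ++ List.replicate 1 j)) /
      (N w * (m : ℚ)⁻¹ ^ k w), ?_⟩
    rw [← h1, ht]
    push_cast
    rfl
  -- Pigeonhole on the bounded N along w j^p: equal values cancel, leaving only powers of t.
  · obtain ⟨p, q, hpq, heq⟩ : ∃ p q : ℕ, p < q ∧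
        N (w ++ List.replicate p j) = N (w ++ List.replicate q j) := by
      obtain ⟨p, -, q, -, hne, heq⟩ := infinite_univ.exists_ne_map_eq_of_mapsTo
        (f := fun p : ℕ => N (w ++ List.replicate p j)) (t := Iic M)
        (fun p _ => (hN _).2) (finite_Iic M)
      rcases lt_or_gt_of_ne hne with h | h
      · exact ⟨p, q, h, heq⟩
      · exact ⟨q, p, h, heq.symm⟩
    refine ⟨q - p, k (w ++ List.replicate p j), k (w ++ List.replicate q j),
      Nat.sub_pos_of_lt hpq, ?_⟩
    have h1 := hpow p
    have h2 := hpow q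
    have hNq : (N (w ++ List.replicate q j) : ℝ) ≠ 0 := by
      have := hN1 (w ++ List.replicate q j); positivity
    have h3 : b j ^ q = b j ^ (q - p) * b j ^ p := by rw [← pow_add]; congr 1; omega
    rw [heq] at h1
    apply mul_left_cancel₀ hNq
    rw [h2, h3, mul_assoc, ← h1]
    ring

/-! ### Arithmetic of the ratios -/

/-- A rational `b` whose powers meet those of `1/m` is a power of `1/r` for any `r` with `r ^ e = m`
that is not a proper power. -/
lemma eq_inv_pow_of_rational {m r e : ℕ} (hm : 2 ≤ m) (hre : r ^ e = m)
    (hr : ∀ c q : ℕ, c ^ q = r → q = 1) {b : ℝ} (hb0 : 0 < b) (hb1 : b < 1)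
    (hq : ∃ q : ℚ, (q : ℝ) = b) {p l l' : ℕ} (hp : 0 < p)
    (h : b ^ p * (m : ℝ)⁻¹ ^ l = (m : ℝ)⁻¹ ^ l') : ∃ k : ℕ, b = (r : ℝ)⁻¹ ^ k := by
  obtain ⟨q, rfl⟩ := hq
  have hm0 : (0 : ℝ) < m := by positivity
  have hm1 : (1 : ℝ) < m := by exact_mod_cast hm
  have hq0 : 0 < q := by exact_mod_cast hb0
  have hll : l ≤ l' := by
    by_contra! hlt
    have h1 : (m : ℝ)⁻¹ ^ l < (m : ℝ)⁻¹ ^ l' :=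
      pow_lt_pow_right_of_lt_one₀ (by positivity) (inv_lt_one_of_one_lt₀ hm1) hlt
    have h2 : (q : ℝ) ^ p * (m : ℝ)⁻¹ ^ l ≤ 1 * (m : ℝ)⁻¹ ^ l := by
      gcongr
      exact pow_le_one₀ hb0.le hb1.le
    linarith
  obtain ⟨s, rfl⟩ := Nat.exists_eq_add_of_le hll
  have h1 : (q⁻¹ : ℚ) ^ p = ((m ^ s : ℕ) : ℚ) := by
    have : (q : ℝ) ^ p = (m : ℝ)⁻¹ ^ s := by
      rw [pow_add, mul_comm] at h
      exact mul_left_cancel₀ (by positivity) h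
    have h2 : q ^ p = (m : ℚ)⁻¹ ^ s := Rat.cast_injective (α := ℝ) (by push_cast; exact this)
    rw [inv_pow, h2]
    simp
  -- A rational with an integral power is integral.
  have hden : (q⁻¹).den = 1 := by
    have h2 := congrArg Rat.den h1
    rw [Rat.den_pow, Rat.den_natCast] at h2
    exact (Nat.pow_eq_one.1 h2).resolve_right hp.ne'
  obtain ⟨y, hy⟩ : ∃ y : ℕ, q⁻¹ = y := by
    obtain ⟨y, hy⟩ := Int.eq_ofNat_of_zero_le (Rat.num_nonneg.2 (inv_pos.2 hq0).le)
    have h3 : (((q⁻¹).num : ℤ) : ℚ) = q⁻¹ := (Rat.den_eq_one_iff _).1 hden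
    exact ⟨y, by rw [← h3, hy]; rfl⟩
  have hys : y ^ p = r ^ (e * s) := by
    rw [hy] at h1
    rw [pow_mul, hre]
    exact_mod_cast h1
  -- Cancelling the gcd gives y^p' = r^s' with coprime exponents, so r is a p'-th power; primitivity
  -- forces p' = 1.
  obtain ⟨k, hk⟩ : ∃ k, y = r ^ k := by
    have hg : 0 < Nat.gcd p (e * s) := Nat.gcd_pos_of_pos_left _ hp
    obtain ⟨p', hp'⟩ := Nat.gcd_dvd_left p (e * s)
    obtain ⟨s', hs'⟩ := Nat.gcd_dvd_right p (e * s)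
    have hcop : Nat.Coprime p' s' := by
      have := Nat.coprime_div_gcd_div_gcd hg
      rwa [Nat.div_eq_of_eq_mul_right hg hp', Nat.div_eq_of_eq_mul_right hg hs'] at this
    have h2 : y ^ p' = r ^ s' := by
      have : (y ^ p') ^ Nat.gcd p (e * s) = (r ^ s') ^ Nat.gcd p (e * s) := by
        rw [← pow_mul, ← pow_mul, mul_comm p', mul_comm s', ← hp', ← hs', hys]
      exact Nat.pow_left_injective hg.ne' this
    obtain ⟨c, hc1, hc2⟩ := Nat.exists_eq_pow_of_exponent_coprime_of_pow_eq_pow hcop h2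
    have hp1 := hr c p' hc2.symm
    rw [hp1, pow_one] at hc2
    exact ⟨s', by rw [hc1, hc2]⟩
  refine ⟨k, ?_⟩
  have h2 : q = (r : ℚ)⁻¹ ^ k := by
    rw [← inv_inv q, hy, hk]
    simp
  rw [h2]
  push_cast
  rfl

/-- Replace m by the base of any nontrivial power representation; the base is smaller, so this
stops. -/
lemma exists_primitive_root {m : ℕ} (hm : 2 ≤ m) :
    ∃ r e : ℕ, 2 ≤ r ∧ 1 ≤ e ∧ r ^ e = m ∧ ∀ c q : ℕ, c ^ q = r → q = 1 := by
  induction m using Nat.strong_induction_on with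
  | _ m ih =>
    by_cases h : ∀ c q : ℕ, c ^ q = m → q = 1
    · exact ⟨m, 1, hm, le_rfl, pow_one m, h⟩
    push Not at h
    obtain ⟨c, q, hcq, hq⟩ := h
    have hq0 : q ≠ 0 := by rintro rfl; simp at hcq; omega
    have hc : 2 ≤ c := by
      by_contra! hc
      interval_cases c
      · simp [hq0] at hcq; omega
      · simp at hcq; omega
    have hlt : c < m := by
      calc c = c ^ 1 := (pow_one c).symm
        _ < c ^ q := Nat.pow_lt_pow_right (by omega) (by omega)
        _ = m := hcq
    obtain ⟨r, e, hr, he, hre, hprim⟩ := ih c hlt hc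
    exact ⟨r, e * q, hr, Nat.mul_pos he (Nat.pos_of_ne_zero hq0), by rw [pow_mul, hre, hcq], hprim⟩

/-! ### Kraft sums and partitions -/

/-- In a finite family of powers of `1/r` with sum `1`, the smallest power occurs at least `r` times,
unless it is `1`. -/
lemma le_card_filter_of_sum_eq_one {ι : Type*} {r : ℕ} (hr : 2 ≤ r) {s : Finset ι} {k : ι → ℕ}
    {i₀ : ι} (hi₀ : i₀ ∈ s) (hmax : ∀ i ∈ s, k i ≤ k i₀) (hk : k i₀ ≠ 0)
    (hs : ∑ i ∈ s, (r : ℝ)⁻¹ ^ k i = 1) : r ≤ (s.filter fun i => k i = k i₀).card := by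
  classical
  have hr0 : (r : ℝ) ≠ 0 := by positivity
  -- Clear denominators and reduce modulo r: only the terms of largest exponent survive, so r
  -- divides their number.
  have h1 : ∑ i ∈ s, r ^ (k i₀ - k i) = r ^ k i₀ := by
    have : ∑ i ∈ s, (r : ℝ) ^ (k i₀ - k i) = (r : ℝ) ^ k i₀ := by
      rw [← mul_one ((r : ℝ) ^ k i₀), ← hs, Finset.mul_sum]
      refine Finset.sum_congr rfl fun i hi => ?_
      rw [pow_sub₀ _ hr0 (hmax i hi), inv_pow]
    exact_mod_cast this
  rw [← Finset.sum_filter_add_sum_filter_not s (fun i => k i = k i₀)] at h1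
  have h2 : ∑ i ∈ s.filter (fun i => k i = k i₀), r ^ (k i₀ - k i) =
      (s.filter fun i => k i = k i₀).card := by
    rw [Finset.card_eq_sum_ones]
    refine Finset.sum_congr rfl fun i hi => ?_
    rw [(Finset.mem_filter.1 hi).2, Nat.sub_self, pow_zero]
  have h3 : r ∣ ∑ i ∈ s.filter (fun i => ¬ k i = k i₀), r ^ (k i₀ - k i) := by
    refine Finset.dvd_sum fun i hi => dvd_pow_self r ?_
    have := hmax i (Finset.mem_filter.1 hi).1
    have := (Finset.mem_filter.1 hi).2
    omega
  rw [h2] at h1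
  have h4 : r ∣ (s.filter fun i => k i = k i₀).card :=
    (Nat.dvd_add_left h3).1 (h1 ▸ dvd_pow_self r hk)
  exact Nat.le_of_dvd (Finset.card_pos.2 ⟨i₀, Finset.mem_filter.2 ⟨hi₀, rfl⟩⟩) h4

/-- Lengths with Kraft sum `1` are the lengths of the words of a partition. -/
lemma DustSystem.exists_words_of_kraft_sum {X : Type*} [MetricSpace X] {r : ℕ} (hr : 2 ≤ r)
    {α : Fin r → ℝ} {f : Fin r → X → X} {E : Set X} (h : DustSystem α f E) {ι : Type*}
    (s : Finset ι) (k : ι → ℕ) (hs : ∑ i ∈ s, (r : ℝ)⁻¹ ^ k i = 1) :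
    ∃ c : ι → List (Fin r), (∀ i ∈ s, (c i).length = k i) ∧
      (∀ i ∈ s, ∀ j ∈ s, i ≠ j → Disjoint (cylinder f E (c i)) (cylinder f E (c j))) ∧
      ∀ x ∈ E, ∃ i ∈ s, x ∈ cylinder f E (c i) := by
  classical
  induction hn : s.card using Nat.strong_induction_on generalizing s k with
  | _ N ih =>
  have hne : s.Nonempty := by
    rw [Finset.nonempty_iff_ne_empty]
    rintro rfl
    simp at hs
  obtain ⟨i₀, hi₀, hmax⟩ := s.exists_max_image k hne
  by_cases hk : k i₀ = 0
  · have hk0 : ∀ i ∈ s, k i = 0 := fun i hi => Nat.le_zero.1 (hk ▸ hmax i hi)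
    have hcard : s.card = 1 := by
      rw [Finset.sum_congr rfl fun i hi => by rw [hk0 i hi, pow_zero]] at hs
      simpa using hs
    obtain ⟨a, rfl⟩ := Finset.card_eq_one.1 hcard
    refine ⟨fun _ => [], fun i hi => (hk0 i hi).symm, fun i hi j hj hij => ?_, fun x hx => ?_⟩
    · rw [Finset.mem_singleton] at hi hj
      exact absurd (hi.trans hj.symm) hij
    · exact ⟨a, Finset.mem_singleton_self a, by simpa⟩
  -- Huffman merging: r longest lengths are replaced by one length shorter by 1, carried by t. The
  -- sum is unchanged and, as r ≥ 2, the family shrinks; afterwards the word of t is split into its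
  -- r children.
  obtain ⟨T, hT, hTr⟩ := Finset.exists_subset_card_eq
    (le_card_filter_of_sum_eq_one hr hi₀ hmax hk hs)
  have hTs : T ⊆ s := hT.trans (Finset.filter_subset _ _)
  have hTk : ∀ i ∈ T, k i = k i₀ := fun i hi => (Finset.mem_filter.1 (hT hi)).2
  obtain ⟨t, ht⟩ : T.Nonempty := Finset.card_pos.1 (by omega)
  let ε : T ≃ Fin r := T.equivFinOfCardEq hTr
  have htn : t ∉ s \ T := fun h => (Finset.mem_sdiff.1 h).2 ht
  have hcard : (insert t (s \ T)).card < N := by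
    rw [Finset.card_insert_of_notMem htn, Finset.card_sdiff_of_subset hTs]
    have := Finset.card_le_card hTs
    omega
  have hsum : ∑ i ∈ insert t (s \ T), (r : ℝ)⁻¹ ^ (Function.update k t (k i₀ - 1)) i = 1 := by
    rw [Finset.sum_insert htn, Function.update_self, ← hs, ← Finset.sum_sdiff hTs, add_comm]
    congr 1
    · refine Finset.sum_congr rfl fun i hi => ?_
      rw [Function.update_of_ne]
      rintro rfl
      exact htn hi
    · rw [Finset.sum_congr rfl fun i hi => by rw [hTk i hi], Finset.sum_const, hTr, nsmul_eq_mul]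
      obtain ⟨K, hK⟩ := Nat.exists_eq_succ_of_ne_zero hk
      rw [hK, Nat.succ_sub_one, pow_succ']
      have hr0 : (r : ℝ) ≠ 0 := by positivity
      field_simp
  obtain ⟨c, hc1, hc2, hc3⟩ := ih _ hcard _ _ hsum rfl
  have hcs : ∀ i ∈ s, i ∉ T → i ∈ insert t (s \ T) := fun i hi hiT =>
    Finset.mem_insert_of_mem (Finset.mem_sdiff.2 ⟨hi, hiT⟩)
  have hct : t ∈ insert t (s \ T) := Finset.mem_insert_self _ _
  refine ⟨fun i => if hi : i ∈ T then c t ++ [ε ⟨i, hi⟩] else c i, fun i hi => ?_,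
    fun i hi j hj hij => ?_, fun x hx => ?_⟩
  · by_cases hiT : i ∈ T
    · have := hc1 t hct
      rw [Function.update_self] at this
      simp only [hiT, dif_pos, List.length_append, this, hTk i hiT, List.length_singleton]
      omega
    · have := hc1 i (hcs i hi hiT)
      rw [Function.update_of_ne (by rintro rfl; exact hiT ht)] at this
      simpa only [hiT, dif_neg, not_false_iff]
  · by_cases hiT : i ∈ T <;> by_cases hjT : j ∈ T <;> simp only [hiT, hjT, dif_pos, dif_neg,
      not_false_iff]
    · exact h.disjoint_concat _ fun he => hij (congrArg Subtype.val (ε.injective he))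
    · exact (hc2 t hct j (hcs j hj hjT) (by rintro rfl; exact hjT ht)).mono_left
        (h.cylinder_append_subset _ _)
    · exact (hc2 i (hcs i hi hiT) t hct (by rintro rfl; exact hiT ht)).mono_right
        (h.cylinder_append_subset _ _)
    · exact hc2 i (hcs i hi hiT) j (hcs j hj hjT) hij
  · obtain ⟨i, hi, hxi⟩ := hc3 x hx
    rcases Finset.mem_insert.1 hi with rfl | hi
    · obtain ⟨p, hp⟩ := h.exists_mem_concat hxi
      refine ⟨ε.symm p, hTs (ε.symm p).2, ?_⟩
      simpa only [Finset.coe_mem, dif_pos, Subtype.coe_eta, Equiv.apply_symm_apply] using hp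
    · obtain ⟨his, hiT⟩ := Finset.mem_sdiff.1 hi
      exact ⟨i, his, by simpa only [hiT, dif_neg, not_false_iff] using hxi⟩

/-! ### Existence of uniform dust-like sets -/

/-- Finitely many continuous maps of a compact set into itself, one of which has a fixed point
there, have a nonempty compact invariant set. -/
lemma exists_compact_invariant {X : Type*} [TopologicalSpace X] [T2Space X] {r : ℕ}
    {f : Fin r → X → X} (hf : ∀ i, Continuous (f i)) {K : Set X} (hK : IsCompact K)
    (hmaps : ∀ i, MapsTo (f i) K K) {p : X} (hp : p ∈ K) {i₀ : Fin r} (hfix : f i₀ p = p) :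
    ∃ E ⊆ K, E.Nonempty ∧ IsCompact E ∧ E = ⋃ i, f i '' E := by
  let Φ : Set X → Set X := fun A => ⋃ i, f i '' A
  have hmono : ∀ {A B : Set X}, A ⊆ B → Φ A ⊆ Φ B := fun h =>
    iUnion_mono fun i => image_mono h
  -- The greatest set with A ⊆ Φ A in K, as in Knaster–Tarski. Its closure has the same property, so
  -- it is closed; {p} has it, so it is nonempty.
  let E : Set X := ⋃₀ {A | A ⊆ K ∧ A ⊆ Φ A}
  have hmax : ∀ A, A ⊆ K → A ⊆ Φ A → A ⊆ E := fun A h1 h2 => subset_sUnion_of_mem ⟨h1, h2⟩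
  have hEK : E ⊆ K := sUnion_subset fun A hA => hA.1
  have hEΦ : E ⊆ Φ E := sUnion_subset fun A hA => hA.2.trans (hmono (subset_sUnion_of_mem hA))
  have hclK : closure E ⊆ K := closure_minimal hEK hK.isClosed
  have hclc : IsCompact (closure E) := hK.of_isClosed_subset isClosed_closure hclK
  have hcl : closure E ⊆ E := by
    refine hmax _ hclK (closure_minimal (hEΦ.trans (hmono subset_closure)) ?_)
    exact (isCompact_iUnion fun i => hclc.image (hf i)).isClosed
  refine ⟨E, hEK, ⟨p, ?_⟩, ?_, hEΦ.antisymm (hmax _ ?_ (hmono hEΦ))⟩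
  · refine hmax {p} (singleton_subset_iff.2 hp) ?_ rfl
    exact singleton_subset_iff.2 (mem_iUnion.2 ⟨i₀, p, rfl, hfix⟩)
  · rwa [subset_closure.antisymm hcl]
  · exact iUnion_subset fun i => (image_mono hEK).trans (hmaps i).image_subset

lemma isCompact_euclidean_box {d : ℕ} (L : Fin d → ℝ) :
    IsCompact {x : EuclideanSpace ℝ (Fin d) | ∀ j, 0 ≤ x j ∧ x j ≤ L j} := by
  have h := isCompact_univ_pi fun j => isCompact_Icc (a := (0 : ℝ)) (b := L j)
  convert (EuclideanSpace.equiv (Fin d) ℝ).toHomeomorph.isCompact_preimage.2 h using 1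
  ext x
  simp only [mem_preimage, mem_univ_pi]
  rfl

/-- Dust-like sets with a uniform contraction vector exist: a box with sides `1, ρ, …, ρ ^ d` splits
into copies of itself, scaled by `ρ` with the coordinates permuted cyclically. -/
lemma exists_isDustLike_uniform {d r : ℕ} (hr : 1 ≤ r) {ρ : ℝ} (hρ0 : 0 < ρ)
    (hrρ : r * ρ ^ (d + 1) < 1) :
    ∃ R b, ∃ E : Set (EuclideanSpace ℝ (Fin (d + 1))),
      IsDustLike (ifsMap (fun _ : Fin r => ρ) R b) E := by
  let S : EuclideanSpace ℝ (Fin (d + 1)) ≃ₗᵢ[ℝ] EuclideanSpace ℝ (Fin (d + 1)) :=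
    LinearIsometryEquiv.piLpCongrLeft 2 ℝ ℝ (finRotate (d + 1))
  -- The shift is applied before rotation and scaling: ρ⁻¹ i/r in the last coordinate becomes i/r in
  -- the first.
  let b : Fin r → EuclideanSpace ℝ (Fin (d + 1)) := fun i =>
    EuclideanSpace.single (Fin.last d) (ρ⁻¹ * ((i : ℝ) / r))
  let f := ifsMap (fun _ : Fin r => ρ) (fun _ => S) b
  have hr0 : (0 : ℝ) < r := by positivity
  have hS : ∀ x j, S x j = x ((finRotate (d + 1)).symm j) := fun x j => rfl
  have hσ0 : (finRotate (d + 1)).symm 0 = Fin.last d := by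
    rw [Equiv.symm_apply_eq, finRotate_last]
  have hσs : ∀ j : Fin d, (finRotate (d + 1)).symm j.succ = j.castSucc := fun j => by
    rw [Equiv.symm_apply_eq, finRotate_apply, Fin.coeSucc_eq_succ]
  have hf0 : ∀ i x, f i x 0 = ρ * x (Fin.last d) + (i : ℝ) / r := fun i x => by
    change ρ * S (x + b i) 0 = _
    rw [hS, hσ0]
    simp [b]
    field_simp
  have hfs : ∀ i x (j : Fin d), f i x j.succ = ρ * x j.castSucc := fun i x j => by
    change ρ * S (x + b i) j.succ = _
    rw [hS, hσs]
    simp [b, (Fin.castSucc_lt_last j).ne]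
  let K : Set (EuclideanSpace ℝ (Fin (d + 1))) := {x | ∀ j, 0 ≤ x j ∧ x j ≤ ρ ^ (j : ℕ)}
  have hKc : IsCompact K := isCompact_euclidean_box fun j => ρ ^ (j : ℕ)
  -- Each image of K has first coordinates in an interval of length ρ^(d+1) starting at i/r, so
  -- distinct images are disjoint.
  have hρr : ρ ^ (d + 1) < 1 / r := by rwa [lt_div_iff₀ hr0, mul_comm]
  have hlast : ∀ x ∈ K, 0 ≤ ρ * x (Fin.last d) ∧ ρ * x (Fin.last d) < 1 / r := fun x hx => by
    refine ⟨mul_nonneg hρ0.le (hx _).1, lt_of_le_of_lt ?_ hρr⟩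
    rw [pow_succ']
    exact mul_le_mul_of_nonneg_left (hx (Fin.last d)).2 hρ0.le
  have hmaps : ∀ i, MapsTo (f i) K K := by
    intro i x hx j
    obtain ⟨h1, h2⟩ := hlast x hx
    refine Fin.cases ?_ (fun j => ?_) j
    · rw [hf0]
      refine ⟨by positivity, ?_⟩
      have hi : (i : ℝ) + 1 ≤ r := by exact_mod_cast i.2
      have : (i : ℝ) / r + 1 / r ≤ 1 := by rw [← add_div]; exact (div_le_one hr0).2 hi
      simp only [Fin.val_zero, pow_zero]
      linarith
    · rw [hfs, Fin.val_succ, pow_succ']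
      have := hx j.castSucc
      exact ⟨mul_nonneg hρ0.le this.1, mul_le_mul_of_nonneg_left this.2 hρ0.le⟩
  have hcont : ∀ i, Continuous (f i) := fun i =>
    (S.continuous.comp (continuous_add_const (b i))).const_smul ρ
  have hfix : f ⟨0, hr⟩ 0 = 0 := by
    ext j
    refine Fin.cases ?_ (fun j => ?_) j
    · rw [hf0]; simp
    · rw [hfs]; simp
  obtain ⟨E, hEK, hne, hc, heq⟩ := exists_compact_invariant hcont hKc hmaps
    (p := 0) (fun j => ⟨le_rfl, by simpa using (pow_pos hρ0 _).le⟩) hfix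
  refine ⟨fun _ => S, b, E, hne, hc, heq, fun i j hij => ?_⟩
  have hlt : ∀ i j : Fin r, i < j → ∀ x ∈ E, ∀ y ∈ E, f i x ≠ f j y := by
    intro i j hij x hx y hy heq
    have h0 := congrArg (fun z : EuclideanSpace ℝ (Fin (d + 1)) => z 0) heq
    simp only [hf0] at h0
    have h1 := hlast x (hEK hx)
    have h2 := hlast y (hEK hy)
    have h3 : (i : ℝ) + 1 ≤ j := by exact_mod_cast hij
    have h4 : (i : ℝ) / r + 1 / r ≤ j / r := by
      rw [← add_div]; exact (div_le_div_iff_of_pos_right hr0).2 h3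
    linarith
  refine disjoint_left.2 ?_
  rintro _ ⟨x, hx, rfl⟩ ⟨y, hy, hxy⟩
  rcases lt_or_gt_of_ne hij with h | h
  · exact hlt i j h x hx y hy hxy.symm
  · exact hlt j i h y hy x hx hxy

/-! ### Derivation chains and Lipschitz equivalence -/

section LipEquiv

variable {d : ℕ} {E F G : Set (EuclideanSpace ℝ (Fin d))}

lemma LipEquiv.symm (h : LipEquiv E F) : LipEquiv F E := by
  obtain ⟨φ, hφ, C, hC, hlip⟩ := h
  let e := Equiv.ofBijective φ hφ
  refine ⟨e.symm, e.symm.bijective, C, hC, fun x y => ?_⟩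
  have h := hlip (e.symm x) (e.symm y)
  have hx : ∀ x, φ (e.symm x) = x := e.apply_symm_apply
  rw [hx, hx] at h
  exact ⟨(inv_mul_le_iff₀ hC).2 h.2, (inv_mul_le_iff₀ hC).1 h.1⟩

lemma LipEquiv.trans (h : LipEquiv E F) (h' : LipEquiv F G) : LipEquiv E G := by
  obtain ⟨φ, hφ, C, hC, hlip⟩ := h
  obtain ⟨ψ, hψ, C', hC', hlip'⟩ := h'
  refine ⟨ψ ∘ φ, hψ.comp hφ, C' * C, mul_pos hC' hC, fun x y => ⟨?_, ?_⟩⟩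
  · rw [mul_inv, mul_assoc]
    exact (mul_le_mul_of_nonneg_left (hlip x y).1 (inv_pos.2 hC').le).trans (hlip' _ _).1
  · rw [mul_assoc]
    exact (hlip' _ _).2.trans (mul_le_mul_of_nonneg_left (hlip x y).2 hC'.le)

end LipEquiv

section Dust

variable {d m n : ℕ} {α : Fin m → ℝ} {β : Fin n → ℝ}

lemma IsDustLike.dustSystem (hα : IsContractionVector d α)
    {R : Fin m → (EuclideanSpace ℝ (Fin d) ≃ₗᵢ[ℝ] EuclideanSpace ℝ (Fin d))}
    {b : Fin m → EuclideanSpace ℝ (Fin d)} {E : Set (EuclideanSpace ℝ (Fin d))}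
    (h : IsDustLike (ifsMap α R b) E) : DustSystem α (ifsMap α R b) E where
  ratio_pos i := (hα.1 i).1
  ratio_lt_one i := (hα.1 i).2
  dist_map i x y := by
    simp only [ifsMap]
    rw [dist_smul₀, (R i).dist_map, dist_add_right, Real.norm_of_nonneg (hα.1 i).1.le]
  nonempty := h.1
  isCompact := h.2.1
  eq_iUnion := h.2.2.1
  disjoint := h.2.2.2

lemma lipEquiv_of_mem_dustLikeSets (hα : IsContractionVector d α)
    {E F : Set (EuclideanSpace ℝ (Fin d))} (hE : E ∈ dustLikeSets d α)
    (hF : F ∈ dustLikeSets d α) : LipEquiv E F := by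
  obtain ⟨R, b, hE⟩ := hE
  obtain ⟨R', b', hF⟩ := hF
  exact (hE.dustSystem hα).exists_biLipschitz (hF.dustSystem hα)

/-- A composition of the maps `ifsMap α R b i` along a word is again of this form. -/
lemma exists_wordMap_ifsMap (hα : ∀ i, 0 < α i)
    (R : Fin m → (EuclideanSpace ℝ (Fin d) ≃ₗᵢ[ℝ] EuclideanSpace ℝ (Fin d)))
    (b : Fin m → EuclideanSpace ℝ (Fin d)) (w : List (Fin m)) :
    ∃ (S : EuclideanSpace ℝ (Fin d) ≃ₗᵢ[ℝ] EuclideanSpace ℝ (Fin d))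
      (c : EuclideanSpace ℝ (Fin d)),
      ∀ x, wordMap (ifsMap α R b) w x = wordRatio α w • S (x + c) := by
  induction w with
  | nil => exact ⟨LinearIsometryEquiv.refl ℝ _, 0, fun x => by simp⟩
  | cons i w ih =>
    obtain ⟨S, c, h⟩ := ih
    -- The second summand is `b i` pulled back through the scaling and S.
    refine ⟨S.trans (R i), c + (wordRatio α w)⁻¹ • S.symm (b i), fun x => ?_⟩
    have h0 := (wordRatio_pos hα w).ne'
    rw [wordMap_cons, Function.comp_apply, h, wordRatio_cons, mul_smul]
    simp only [ifsMap, LinearIsometryEquiv.trans_apply]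
    rw [← map_smul (R i) (wordRatio α w), ← add_assoc, map_add S (x + c), smul_add, map_smul S,
      LinearIsometryEquiv.apply_symm_apply, smul_inv_smul₀ h0]

/-- A derived vector has a dust-like set in common with the original one. -/
lemma IsDerivedFrom.exists_mem_mem (h : IsDerivedFrom d α β) :
    ∃ E, E ∈ dustLikeSets d α ∧ E ∈ dustLikeSets d β := by
  obtain ⟨-, hβ, R, b, E, hE, j, hj, hpart, hratio⟩ := h
  choose S c hSc using fun i => exists_wordMap_ifsMap (fun i => (hβ.1 i).1) R b (j i)
  have hmap : ∀ i, ifsMap α S c i = wordMap (ifsMap β R b) (j i) := fun i => by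
    funext x
    rw [hSc, ifsMap, hratio]
  refine ⟨E, ⟨S, c, hE.1, hE.2.1, ?_, fun i i' hii => ?_⟩, ⟨R, b, hE⟩⟩
  · simp only [hmap]
    exact hpart.1.trans biUnion_range
  · simp only [hmap]
    exact hpart.2 (mem_range_self i) (mem_range_self i') (hj.ne hii)

/-- Neighbouring vectors share a dust-like set, through which equivalences are composed. -/
lemma VectorEquiv.lipEquiv (hα : IsContractionVector d α) (h : VectorEquiv d α β)
    {E F : Set (EuclideanSpace ℝ (Fin d))} (hE : E ∈ dustLikeSets d α)
    (hF : F ∈ dustLikeSets d β) : LipEquiv E F := by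
  suffices H : ∀ v : (k : ℕ) × (Fin k → ℝ), Relation.ReflTransGen
      (fun u v : (k : ℕ) × (Fin k → ℝ) => IsDerivedFrom d v.2 u.2 ∨ IsDerivedFrom d u.2 v.2)
      ⟨m, α⟩ v → IsContractionVector d v.2 ∧ ∀ F ∈ dustLikeSets d v.2, LipEquiv E F from
    (H ⟨n, β⟩ h).2 F hF
  intro v hv
  induction hv with
  | refl => exact ⟨hα, fun F hF => lipEquiv_of_mem_dustLikeSets hα hE hF⟩
  | @tail u v _ huv ih =>
    obtain ⟨hv, G, hGu, hGv⟩ : IsContractionVector d v.2 ∧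
        ∃ G, G ∈ dustLikeSets d u.2 ∧ G ∈ dustLikeSets d v.2 := by
      rcases huv with h | h
      · obtain ⟨G, h1, h2⟩ := h.exists_mem_mem
        exact ⟨h.1, G, h2, h1⟩
      · obtain ⟨G, h1, h2⟩ := h.exists_mem_mem
        exact ⟨h.2.1, G, h1, h2⟩
    exact ⟨hv, fun F hF => (ih.2 G hGu).trans (lipEquiv_of_mem_dustLikeSets hv hGv hF)⟩

/-- Every link exhibits sets at both of its ends; only the trivial chain provides none. -/
lemma VectorEquiv.eq_or_nonempty (h : VectorEquiv d α β) :
    (⟨m, α⟩ : (k : ℕ) × (Fin k → ℝ)) = ⟨n, β⟩ ∨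
      (dustLikeSets d α).Nonempty ∧ (dustLikeSets d β).Nonempty := by
  have aux : ∀ u v : (k : ℕ) × (Fin k → ℝ), IsDerivedFrom d v.2 u.2 ∨ IsDerivedFrom d u.2 v.2 →
      (dustLikeSets d u.2).Nonempty ∧ (dustLikeSets d v.2).Nonempty := by
    rintro u v (h | h)
    · obtain ⟨G, h1, h2⟩ := h.exists_mem_mem
      exact ⟨⟨G, h2⟩, ⟨G, h1⟩⟩
    · obtain ⟨G, h1, h2⟩ := h.exists_mem_mem
      exact ⟨⟨G, h1⟩, ⟨G, h2⟩⟩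
  rcases Relation.ReflTransGen.cases_head h with heq | ⟨u, hu, -⟩
  · exact Or.inl heq
  rcases Relation.ReflTransGen.cases_tail h with heq | ⟨v, -, hv⟩
  · exact Or.inl heq.symm
  · exact Or.inr ⟨(aux _ _ hu).1, (aux _ _ hv).2⟩

/-- A vector of powers of `ρ` whose exponents have Kraft sum `1` is derived from the uniform vector
`(ρ, …, ρ)` of length `r`. -/
lemma isDerivedFrom_uniform {r : ℕ} (hr : 2 ≤ r) {ρ : ℝ} (hρ0 : 0 < ρ) (hρ1 : ρ < 1)
    (hd : d ≠ 0) (hrρ : r * ρ ^ d < 1) (hβ : IsContractionVector d β) {k : Fin n → ℕ}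
    (hk : ∀ j, β j = ρ ^ k j) (hsum : ∑ j, (r : ℝ)⁻¹ ^ k j = 1) :
    IsDerivedFrom d β (fun _ : Fin r => ρ) := by
  have hρ : IsContractionVector d (fun _ : Fin r => ρ) :=
    ⟨fun _ => ⟨hρ0, hρ1⟩, by simpa using hrρ⟩
  obtain ⟨d, rfl⟩ := Nat.exists_eq_succ_of_ne_zero hd
  obtain ⟨R, b, E, hE⟩ := exists_isDustLike_uniform (by omega) hρ0 hrρ
  have hS := hE.dustSystem hρ
  obtain ⟨c, hc1, hc2, hc3⟩ := hS.exists_words_of_kraft_sum hr Finset.univ k hsum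
  have hdis : ∀ i j, i ≠ j → Disjoint (cylinder (ifsMap (fun _ => ρ) R b) E (c i))
      (cylinder (ifsMap (fun _ => ρ) R b) E (c j)) := fun i j =>
    hc2 i (Finset.mem_univ _) j (Finset.mem_univ _)
  refine ⟨hβ, hρ, R, b, E, hE, c, fun i j hij => ?_, ⟨?_, ?_⟩, fun i => ?_⟩
  · by_contra hne
    have := hdis i j hne
    rw [hij, disjoint_self, bot_eq_empty] at this
    exact (hS.cylinder_nonempty _).ne_empty this
  · rw [biUnion_range]
    refine Subset.antisymm (fun x hx => ?_) (iUnion_subset fun i => hS.cylinder_subset (c i))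
    obtain ⟨i, -, hi⟩ := hc3 x hx
    exact mem_iUnion.2 ⟨i, hi⟩
  · rintro _ ⟨i, rfl⟩ _ ⟨j, rfl⟩ hij
    exact hdis i j fun h => hij (by rw [h])
  · rw [wordRatio_const, hc1 i (Finset.mem_univ _), hk]

end Dust

/-! ### One-piece systems and extraction of the common root -/

namespace DustSystem

variable {X : Type*} [MetricSpace X] {m : ℕ} {α : Fin m → ℝ} {f : Fin m → X → X} {E : Set X}

lemma one_le_card (h : DustSystem α f E) : 1 ≤ m := by
  by_contra! hm
  obtain rfl : m = 0 := by omega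
  have := h.eq_iUnion
  rw [iUnion_of_empty] at this
  exact h.nonempty.ne_empty this

lemma card_eq_one_iff (h : DustSystem α f E) : m = 1 ↔ E.Subsingleton := by
  constructor
  · rintro rfl x hx y hy
    by_contra hxy
    obtain ⟨u, i, hxi, hyu, hyi⟩ := h.exists_separating_word hx hy hxy
    obtain ⟨j, hj⟩ := h.exists_mem_concat hyu
    exact hyi (Subsingleton.elim j i ▸ hj)
  · intro hs
    by_contra hm
    have hm2 : 2 ≤ m := by have := h.one_le_card; omega
    have hne : (⟨0, by omega⟩ : Fin m) ≠ ⟨1, by omega⟩ := by simp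
    obtain ⟨x, hx⟩ := h.cylinder_nonempty [⟨0, by omega⟩]
    obtain ⟨y, hy⟩ := h.cylinder_nonempty [⟨1, by omega⟩]
    have := hs (h.cylinder_subset _ hx) (h.cylinder_subset _ hy)
    exact disjoint_left.1 (h.disjoint_concat [] hne) hx (this ▸ hy)

end DustSystem

lemma LipEquiv.subsingleton {d : ℕ} {E F : Set (EuclideanSpace ℝ (Fin d))} (h : LipEquiv E F)
    (hE : E.Subsingleton) : F.Subsingleton := by
  obtain ⟨φ, hφ, -⟩ := h
  intro x hx y hy
  obtain ⟨x', hx'⟩ := hφ.2 ⟨x, hx⟩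
  obtain ⟨y', hy'⟩ := hφ.2 ⟨y, hy⟩
  have : x' = y' := Subtype.ext (hE x'.2 y'.2)
  rw [this, hy'] at hx'
  exact (congrArg Subtype.val hx').symm

lemma wordRatio_rpow {n : ℕ} {β : Fin n → ℝ} (hβ : ∀ j, 0 < β j) (s : ℝ) (w : List (Fin n)) :
    wordRatio (fun j => β j ^ s) w = wordRatio β w ^ s := by
  induction w with
  | nil => simp
  | cons i w ih =>
    rw [wordRatio_cons, wordRatio_cons, ih, Real.mul_rpow (hβ i).le (wordRatio_pos hβ w).le]

/-- A dust-like set Lipschitz equivalent to one of uniform ratio `a` with `m` pieces has ratios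
that are powers of a root `ρ` of `a`, whose exponents have Kraft sum `1` for the corresponding root
`r` of `m`. -/
lemma exists_root_of_lipEquiv {d m n : ℕ} {a : ℝ} {β : Fin n → ℝ}
    {f : Fin m → EuclideanSpace ℝ (Fin d) → EuclideanSpace ℝ (Fin d)}
    {g : Fin n → EuclideanSpace ℝ (Fin d) → EuclideanSpace ℝ (Fin d)}
    {E F : Set (EuclideanSpace ℝ (Fin d))} (hE : DustSystem (fun _ : Fin m => a) f E)
    (hF : DustSystem β g F) (hm : 2 ≤ m) (ha0 : 0 < a) (ha1 : a < 1) (hEF : LipEquiv F E) :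
    ∃ (r e : ℕ) (ρ : ℝ) (k : Fin n → ℕ), 2 ≤ r ∧ 1 ≤ e ∧ r ^ e = m ∧ 0 < ρ ∧ ρ < 1 ∧
      ρ ^ e = a ∧ (∀ j, β j = ρ ^ k j) ∧ ∑ j, (r : ℝ)⁻¹ ^ k j = 1 := by
  obtain ⟨ψ, hψ, C, hC, hlip⟩ := hEF
  obtain ⟨N, k, M, B, hB, hN, hk, hadd⟩ :=
    hE.exists_cylinder_counts hF ha0 ha1 (by omega) hψ hC hlip
  obtain ⟨r, e, hr, he, hre, hprim⟩ := exists_primitive_root hm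
  have hm1 : (1 : ℝ) < m := by exact_mod_cast hm
  have hlog : Real.log a < 0 := Real.log_neg ha0 ha1
  -- The similarity dimension of E; raising to the power s turns ratios a^k into weights m^{-k}.
  let s : ℝ := Real.log m / -Real.log a
  have hs : 0 < s := div_pos (Real.log_pos hm1) (by linarith)
  have has : a ^ s = (m : ℝ)⁻¹ := by
    rw [Real.rpow_def_of_pos ha0, ← Real.exp_log (by linarith : (0 : ℝ) < m), ← Real.exp_neg]
    congr 1
    simp only [s]
    have := hlog.ne
    field_simp
  have hpows : ∀ l : ℕ, (a ^ l) ^ s = (m : ℝ)⁻¹ ^ l := fun l => by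
    rw [← has, ← Real.rpow_natCast, ← Real.rpow_natCast, ← Real.rpow_mul ha0.le,
      ← Real.rpow_mul ha0.le, mul_comm]
  have hb : ∀ j, 0 < β j ^ s := fun j => Real.rpow_pos_of_pos (hF.ratio_pos j) s
  obtain ⟨hsum, hw⟩ := weights_of_counts hm hb (B := B ^ s) (Real.rpow_pos_of_pos hB s) hN
    (fun w => by
      rw [wordRatio_rpow hF.ratio_pos, ← hpows, ← Real.mul_rpow hB.le (by positivity),
        ← Real.mul_rpow hB.le (hF.word_pos w).le]
      exact ⟨Real.rpow_le_rpow (hF.word_pos w).le (hk w).1 hs.le,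
        Real.rpow_le_rpow (by positivity) (hk w).2 hs.le⟩) hadd
  have hexp : ∀ j, ∃ l : ℕ, β j ^ s = (r : ℝ)⁻¹ ^ l := fun j => by
    obtain ⟨hq, p, l, l', hp, h⟩ := hw j
    exact eq_inv_pow_of_rational hm hre hprim (hb j)
      (Real.rpow_lt_one (hF.ratio_pos j).le (hF.ratio_lt_one j) hs) hq hp h
  choose κ hκ using hexp
  have he0 : e ≠ 0 := by omega
  let ρ : ℝ := a ^ ((e : ℝ)⁻¹)
  have hρ0 : 0 < ρ := Real.rpow_pos_of_pos ha0 _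
  have hρe : ρ ^ e = a := Real.rpow_inv_natCast_pow ha0.le he0
  have hρ1 : ρ < 1 := Real.rpow_lt_one ha0.le ha1 (by positivity)
  have hρs : ρ ^ s = (r : ℝ)⁻¹ := by
    have h1 : (ρ ^ s) ^ e = ((r : ℝ)⁻¹) ^ e := by
      rw [← Real.rpow_natCast, ← Real.rpow_mul hρ0.le, mul_comm, Real.rpow_mul hρ0.le,
        Real.rpow_natCast, hρe, has, inv_pow, ← hre]
      push_cast
      rfl
    exact (pow_left_inj₀ (Real.rpow_nonneg hρ0.le _) (by positivity) he0).1 h1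
  refine ⟨r, e, ρ, κ, hr, he, hre, hρ0, hρ1, hρe, fun j => ?_, ?_⟩
  · have h1 : β j ^ s = (ρ ^ κ j) ^ s := by
      rw [hκ, ← hρs, ← Real.rpow_natCast, ← Real.rpow_natCast, ← Real.rpow_mul hρ0.le,
        ← Real.rpow_mul hρ0.le, mul_comm]
    exact (Real.rpow_left_inj (hF.ratio_pos j).le (by positivity) hs.ne').1 h1
  · rw [← hsum]
    exact Finset.sum_congr rfl fun j _ => (hκ j).symm

theorem mainTheorem3 (d m n : ℕ) (a : ℝ) (β : Fin n → ℝ)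
    (hα : IsContractionVector d (fun _ : Fin m => a)) (hβ : IsContractionVector d β)
    (hmn : 2 ≤ m ∨ 2 ≤ n) :
    (DustLipEquiv d (fun _ : Fin m => a) β ↔ VectorEquiv d (fun _ : Fin m => a) β) ∧
      (DustLipEquiv d (fun _ : Fin m => a) β →
        ∀ E ∈ dustLikeSets d (fun _ : Fin m => a), ∀ F ∈ dustLikeSets d β, LipEquiv E F) := by
  -- For d = 0 the sums in the contraction condition are m and n, so both would vanish.
  have hd : d ≠ 0 := by
    rintro rfl
    have h1 := hα.2
    have h2 := hβ.2
    simp only [pow_zero, Finset.sum_const, Finset.card_univ, Fintype.card_fin, nsmul_eq_mul,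
      mul_one] at h1 h2
    have h3 : m < 1 := by exact_mod_cast h1
    have h4 : n < 1 := by exact_mod_cast h2
    omega
  have forward : DustLipEquiv d (fun _ : Fin m => a) β → VectorEquiv d (fun _ : Fin m => a) β := by
    rintro ⟨E, ⟨R, b, hE⟩, F, ⟨R', b', hF⟩, hEF⟩
    have hE' := hE.dustSystem hα
    have hF' := hF.dustSystem hβ
    -- If m = 1 then E is a point, hence so is F, and n = 1.
    have hm : 2 ≤ m := by
      by_contra! hm
      have hm1 : m = 1 := by have := hE'.one_le_card; omega
      have := hF'.card_eq_one_iff.2 (hEF.subsingleton (hE'.card_eq_one_iff.1 hm1))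
      omega
    obtain ⟨ha0, ha1⟩ := hα.1 ⟨0, by omega⟩
    obtain ⟨r, e, ρ, k, hr, he, hre, hρ0, hρ1, hρe, hk, hsum⟩ :=
      exists_root_of_lipEquiv hE' hF' hm ha0 ha1 hEF.symm
    have hrρ : r * ρ ^ d < 1 := by
      -- The left side equals m a^d.
      have h1 : (r * ρ ^ d) ^ e < 1 := by
        have h2 := hα.2
        simp only [Finset.sum_const, Finset.card_univ, Fintype.card_fin, nsmul_eq_mul] at h2
        rw [mul_pow, ← pow_mul, mul_comm d, pow_mul, hρe]
        rw [← hre] at h2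
        exact_mod_cast h2
      by_contra! hge
      exact absurd (one_le_pow₀ hge) (not_le.2 h1)
    have hr0 : (r : ℝ) ≠ 0 := by positivity
    have dα : IsDerivedFrom d (fun _ : Fin m => a) (fun _ : Fin r => ρ) := by
      refine isDerivedFrom_uniform hr hρ0 hρ1 hd hrρ hα (k := fun _ => e) (fun _ => hρe.symm) ?_
      rw [Finset.sum_const, Finset.card_univ, Fintype.card_fin, nsmul_eq_mul, ← hre, inv_pow]
      push_cast
      field_simp
    have dβ : IsDerivedFrom d β (fun _ : Fin r => ρ) :=
      isDerivedFrom_uniform hr hρ0 hρ1 hd hrρ hβ hk hsum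
    exact Relation.ReflTransGen.head (b := (⟨r, fun _ => ρ⟩ : (k : ℕ) × (Fin k → ℝ))) (Or.inr dα)
      (Relation.ReflTransGen.single (Or.inl dβ))
  refine ⟨⟨forward, fun h => ?_⟩, fun h E hE F hF => (forward h).lipEquiv hα hE hF⟩
  obtain ⟨⟨E, hE⟩, ⟨F, hF⟩⟩ : (dustLikeSets d (fun _ : Fin m => a)).Nonempty ∧
      (dustLikeSets d β).Nonempty := by
    rcases h.eq_or_nonempty with heq | hne
    -- The trivial chain needs a member of the uniform class, supplied by the box construction.
    · obtain ⟨rfl, hβ'⟩ := Sigma.mk.inj_iff.1 heq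
      obtain rfl := eq_of_heq hβ'
      have hm : 2 ≤ m := by omega
      obtain ⟨d, rfl⟩ := Nat.exists_eq_succ_of_ne_zero hd
      obtain ⟨R, b, E, hE⟩ := exists_isDustLike_uniform (d := d) (r := m) (by omega)
        (hα.1 ⟨0, by omega⟩).1 (by simpa using hα.2)
      exact ⟨⟨E, R, b, hE⟩, ⟨E, R, b, hE⟩⟩
    · exact hne
  exact ⟨E, hE, F, hF, h.lipEquiv hα hE hF⟩
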